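/- Let $\mathbb H$ be the upper half-plane, $q=e^{2\pi i\tau}$ for $\tau\in\mathbb H$, and let $E_2(\tau)=1-24\sum_{n\ge1}\sigma_1(n)q^n$ and $E_4(\tau)=1+240\sum_{n\ge1}\sigma_3(n)q^n$ be the normalized Eisenstein series. For $N\in\{2,3\}$ put $s_N=(N+1)/12$ and $$F_2(\tau)=\frac{N E_2(N\tau)-E_2(\tau)}{N-1},\qquad F_4(\tau)=\frac{N^2E_4(N\tau)-E_4(\tau)}{N^2-1},\qquad J_N(\tau)=\frac{F_2(\tau)^4}{F_2(\tau)^4-F_4(\tau)^2},$$ $$P_2(\tau)=\frac{N E_2(N\tau)+E_2(\tau)}{N+1},\qquad P_2^*(\tau)=P_2(\tau)-\frac{6}{(N+1)\pi\,\mathrm{Im}(\tau)}.$$ Let $(x)_n=x(x+1)\cdots(x+n-1)$ and, for integers $d\ge2$ and $n\ge0$, $R_n(d)=\prod_{1\le i\le d,\ \gcd(i,d)=1}\frac{(i/d)_n}{n!}$. Let $\mathcal U_N$ be the set of all $\tau\in\mathbb H$ such that $|J_N(\tau+it)|>1$ for all real $t\ge0$. Then, for $N=2$ and $N=3$, there is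 a real $Y$ such that $\mathcal U_N$ contains all $\tau$ with $\mathrm{Im}(\tau)>Y$, and for all $\tau\in\mathcal U_N$ $$F_2(\tau)^{1/2}={}_2F_1\Big(\frac{s_N}{2},\frac{1-s_N}{2};1;\frac1{J_N(\tau)}\Big),\qquad F_2(\tau)={}_3F_2\Big(\frac12,s_N,1-s_N;1,1;\frac1{J_N(\tau)}\Big),$$ where the square root is the principal one. Moreover, for $N=2$ and all $\tau\in\mathcal U_2$, $$\sum_{n\ge0}\Big(4n+1-\frac{P_2^*F_2}{F_4}(\tau)\Big)\frac{R_n(2)R_n(4)}{J_2(\tau)^n}=\frac{2}{\pi\,\mathrm{Im}(\tau)}\,\frac{F_2^2}{F_4}(\tau),$$ and for $N=3$ and all $\tau\in\mathcal U_3$, $$\sum_{n\ge0}\Big(3n+1-\frac{P_2^*F_2}{F_4}(\tau)\Big)\frac{R_n(2)R_n(3)}{J_3(\tau)^n}=\frac{3}{2\pi\,\mathrm{Im}(\tau)}\,\frac{F_2^2}{F_4}(\tau),$$ all series being absolutely convergent. -/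

import Mathlib

open UpperHalfPlane

namespace RamanujanPi

noncomputable section

/-- The point `N τ` of the upper half-plane (for `N ≥ 1`). -/
def scale (N : ℕ) (τ : ℍ) : ℍ := ofComplex ((N : ℂ) * (τ : ℂ))

/-- `F₂(τ) = (N E₂(Nτ) - E₂(τ)) / (N - 1)`. -/
def F2 (N : ℕ) (τ : ℍ) : ℂ :=
  ((N : ℂ) * EisensteinSeries.E2 (scale N τ) - EisensteinSeries.E2 τ) / ((N : ℂ) - 1)

/-- `F₄(τ) = (N² E₄(Nτ) - E₄(τ)) / (N² - 1)`. -/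
def F4 (N : ℕ) (τ : ℍ) : ℂ :=
  ((N : ℂ) ^ 2 * ModularForm.E₄ (scale N τ) - ModularForm.E₄ τ) / ((N : ℂ) ^ 2 - 1)

/-- `J_N = F₂⁴ / (F₂⁴ - F₄²)`. -/
def JN (N : ℕ) (τ : ℍ) : ℂ := F2 N τ ^ 4 / (F2 N τ ^ 4 - F4 N τ ^ 2)

/-- `P₂(τ) = (N E₂(Nτ) + E₂(τ)) / (N + 1)`. -/
def P2 (N : ℕ) (τ : ℍ) : ℂ :=
  ((N : ℂ) * EisensteinSeries.E2 (scale N τ) + EisensteinSeries.E2 τ) / ((N : ℂ) + 1)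

/-- `P₂*(τ) = P₂(τ) - 6 / ((N + 1) π Im τ)`. -/
def P2star (N : ℕ) (τ : ℍ) : ℂ :=
  P2 N τ - 6 / (((N : ℂ) + 1) * (Real.pi : ℂ) * (τ.im : ℂ))

/-- `s_N = (N + 1) / 12`. -/
def s (N : ℕ) : ℂ := ((N : ℂ) + 1) / 12

/-- `(x)_n = x (x + 1) ⋯ (x + n - 1)`. -/
def poch (x : ℂ) (n : ℕ) : ℂ := (ascPochhammer ℂ n).eval x

/-- `R_n(d) = ∏ (i/d)_n / n!`, over `1 ≤ i ≤ d` with `gcd(i, d) = 1`. -/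
def R (n d : ℕ) : ℂ :=
  ∏ i ∈ (Finset.Icc 1 d).filter (fun i => Nat.gcd i d = 1),
    poch ((i : ℂ) / (d : ℂ)) n / (n.factorial : ℂ)

/-- The region attached to the cusp `i∞` on which the series in `1/J_N` are considered: the points
`τ` such that `|J_N| > 1` on the whole vertical half-line going up from `τ`. -/
def cuspRegion (N : ℕ) : Set ℍ :=
  {τ | ∀ τ' : ℍ, τ'.re = τ.re → τ.im ≤ τ'.im → 1 < ‖JN N τ'‖}

end

end RamanujanPi

open RamanujanPi

namespace RamanujanPi

noncomputable section

open Filter Topology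

/-! ### Power series with polynomially bounded coefficients -/

/-! Put w = F₄/F₂², so that 1/J_N = 1 - w². Write D for (2πi)⁻¹ d/dτ, θ for the Euler operator x
d/dx, and y for the value of ₂F₁(s/2, (1-s)/2; 1; ·) at 1/J_N. Everything follows from y² = F₂ and
one differentiation of it.

Ramanujan's equations for E₂, E₄, E₆ and the relation N²E₄(Nτ) + E₄(τ) = (N²+1)F₂² give a closed
system: DF₂ = s(P₂F₂ - F₄), DP₂ = (s/2)(P₂² - F₂²), Dw = -F₂(1 - w²)/2. The modular identities
behind it come from `eq_zero_of_fricke_symmetric`: a holomorphic function with Fricke symmetry of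
small weight that is O(q) vanishes, because its twelfth power divided by a power of Δ(τ)Δ(Nτ) has
invariant absolute value and violates the maximum principle. The weight six relation and Dw are then
obtained by differentiating the weight four relation.

With r = (s/2)(P₂/F₂ - w) (`riccati`), the pairs (√F₂, r√F₂) and (y, wθy) solve the same linear
system of order two. Their Wronskian is constant on vertical rays and tends to 0 at the cusp, so wθy
= ry (`GoodRay.w_mul_eulerHypJ`). Then y²/F₂ is constant with limit 1 (`GoodRay.hypJ_sq`). The bound
|y - 1| ≤ 1/4 makes y the principal square root.

Clausen's formula turns y² into the ₃F₂, and θ(y²) = 2yθy evaluates the same series weighted by n.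
In the right combination of the two sums only P₂ - P₂* survives, which is the term in 1/π. -/

/-- The sum of the power series with coefficients `a`. -/
def powerSum (a : ℕ → ℂ) (x : ℂ) : ℂ := ∑' n, a n * x ^ n

/-- The sequence `a` grows at most polynomially. -/
def PolyBounded (a : ℕ → ℂ) : Prop := ∃ (C : ℝ) (k : ℕ), ∀ n, ‖a n‖ ≤ C * ((n : ℝ) + 1) ^ k

lemma summable_add_one_pow_mul_geometric (k : ℕ) {r : ℝ} (h0 : 0 ≤ r) (h1 : r < 1) :
    Summable fun n : ℕ => ((n : ℝ) + 1) ^ k * r ^ n := by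
  -- The index shift divides by the ratio, which r = 0 would forbid; (r + 1)/2 is positive, below 1
  -- and dominates r.
  have h := summable_pow_mul_geometric_of_norm_lt_one (R := ℝ) k
    (show ‖(r + 1) / 2‖ < 1 by rw [Real.norm_of_nonneg (by linarith)]; linarith)
  have h' := ((summable_nat_add_iff 1).2 h).mul_left ((r + 1) / 2)⁻¹
  refine Summable.of_nonneg_of_le (fun n => by positivity) (fun n => ?_) h'
  have : ((r + 1) / 2)⁻¹ * (((n + 1 : ℕ) : ℝ) ^ k * ((r + 1) / 2) ^ (n + 1))
      = ((n : ℝ) + 1) ^ k * ((r + 1) / 2) ^ n := by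
    have : (r + 1) / 2 ≠ 0 := by positivity
    rw [pow_succ ((r + 1) / 2)]
    push_cast
    field_simp
  rw [this]
  gcongr
  linarith

lemma PolyBounded.summable_norm {a : ℕ → ℂ} (ha : PolyBounded a) {x : ℂ} (hx : ‖x‖ < 1) :
    Summable fun n => ‖a n * x ^ n‖ := by
  obtain ⟨C, k, h⟩ := ha
  refine Summable.of_nonneg_of_le (fun n => norm_nonneg _) (fun n => ?_)
    ((summable_add_one_pow_mul_geometric k (norm_nonneg x) hx).mul_left C)
  rw [norm_mul, norm_pow, ← mul_assoc]
  gcongr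
  exact h n

lemma PolyBounded.hasSum {a : ℕ → ℂ} (ha : PolyBounded a) {x : ℂ} (hx : ‖x‖ < 1) :
    HasSum (fun n => a n * x ^ n) (powerSum a x) :=
  (ha.summable_norm hx).of_norm.hasSum

lemma PolyBounded.nat_mul {a : ℕ → ℂ} (ha : PolyBounded a) :
    PolyBounded fun n => (n : ℂ) * a n := by
  obtain ⟨C, k, h⟩ := ha
  refine ⟨C, k + 1, fun n => ?_⟩
  rw [norm_mul, Complex.norm_natCast]
  have h1 : (n : ℝ) * ‖a n‖ ≤ ((n : ℝ) + 1) * (C * ((n : ℝ) + 1) ^ k) := by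
    gcongr
    · linarith
    · exact h n
  calc _ ≤ _ := h1
    _ = _ := by ring

lemma PolyBounded.shift {a : ℕ → ℂ} (ha : PolyBounded a) :
    PolyBounded fun n => a (n + 1) := by
  obtain ⟨C, k, h⟩ := ha
  have hC : 0 ≤ C := by simpa using (norm_nonneg _).trans (h 0)
  refine ⟨C * 2 ^ k, k, fun n => (h (n + 1)).trans ?_⟩
  rw [mul_assoc, ← mul_pow]
  push_cast
  gcongr
  linarith [(Nat.cast_nonneg n : (0 : ℝ) ≤ n)]

lemma PolyBounded.deriv {a : ℕ → ℂ} (ha : PolyBounded a) :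
    PolyBounded fun n => ((n : ℂ) + 1) * a (n + 1) := by
  simpa using ha.nat_mul.shift

lemma PolyBounded.hasDerivAt {a : ℕ → ℂ} (ha : PolyBounded a) {x : ℂ} (hx : ‖x‖ < 1) :
    HasDerivAt (powerSum a) (powerSum (fun n => ((n : ℂ) + 1) * a (n + 1)) x) x := by
  obtain ⟨r, hxr, hr1⟩ := exists_between hx
  have hr0 : 0 < r := (norm_nonneg x).trans_lt hxr
  have hrn : ‖(r : ℂ)‖ = r := by simp [hr0.le]
  have hu : Summable fun n : ℕ => ‖(n : ℂ) * a n * (r : ℂ) ^ (n - 1)‖ := by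
    refine (summable_nat_add_iff 1).1 ?_
    simpa using ha.deriv.summable_norm (x := (r : ℂ)) (by rwa [hrn])
  have hmem : x ∈ Metric.ball (0 : ℂ) r := by simpa using hxr
  have key := hasDerivAt_tsum_of_isPreconnected (g := fun n y => a n * y ^ n)
    (g' := fun n y => (n : ℂ) * a n * y ^ (n - 1)) hu Metric.isOpen_ball
    (convex_ball (0 : ℂ) r).isPreconnected
    (fun n y _ => by
      have := (hasDerivAt_pow n y).const_mul (a n)
      refine this.congr_deriv ?_
      ring)
    (fun n y hy => by
      have hy' : ‖y‖ ≤ r := by simpa using (Metric.mem_ball.1 hy).le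
      simp only [norm_mul, norm_pow, hrn]
      gcongr)
    (Metric.mem_ball_self hr0)
    (ha.summable_norm (x := 0) (by simp)).of_norm hmem
  refine key.congr_deriv ?_
  have hs : Summable fun n : ℕ => (n : ℂ) * a n * x ^ (n - 1) := by
    refine (summable_nat_add_iff 1).1 ?_
    simpa using (ha.deriv.summable_norm hx).of_norm
  rw [hs.tsum_eq_zero_add]
  simp [powerSum]

lemma powerSum_zero (a : ℕ → ℂ) : powerSum a 0 = a 0 := by
  rw [powerSum, tsum_eq_single 0]
  · simp
  · intro n hn
    simp [hn]

/-- Weighting the coefficients by n is the Euler operator x d/dx; this is the form in which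
derivatives are used later. -/
lemma PolyBounded.powerSum_nat_mul {a : ℕ → ℂ} (ha : PolyBounded a) {x : ℂ} (hx : ‖x‖ < 1) :
    powerSum (fun n => (n : ℂ) * a n) x
      = x * powerSum (fun n => ((n : ℂ) + 1) * a (n + 1)) x := by
  rw [powerSum, (ha.nat_mul.summable_norm hx).of_norm.tsum_eq_zero_add, powerSum, ← tsum_mul_left]
  simp only [Nat.cast_zero, zero_mul, zero_add]
  refine tsum_congr fun n => ?_
  push_cast
  ring

end

end RamanujanPi

namespace RamanujanPi

noncomputable section

open Filter Topology Asymptotics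
open scoped Manifold ModularForm

/-! ### A vanishing criterion for functions with Fricke symmetry -/

/-- The filter of complex numbers whose imaginary part tends to infinity. -/
abbrev imInfty : Filter ℂ := comap Complex.im atTop

/-- The nome `q = exp (2 π i z)`. -/
def nome (z : ℂ) : ℂ := Complex.exp (2 * Real.pi * Complex.I * z)

lemma nome_ne_zero (z : ℂ) : nome z ≠ 0 := Complex.exp_ne_zero _

lemma norm_nome (z : ℂ) : ‖nome z‖ = Real.exp (-2 * Real.pi * z.im) := by
  simp [nome, Complex.norm_exp]

lemma norm_nome_lt_one {z : ℂ} (hz : 0 < z.im) : ‖nome z‖ < 1 := by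
  rw [norm_nome, Real.exp_lt_one_iff]
  nlinarith [mul_pos Real.pi_pos hz]

lemma nome_natCast_mul (N : ℕ) (z : ℂ) : nome (N * z) = nome z ^ N := by
  rw [nome, nome, ← Complex.exp_nat_mul]
  ring_nf

lemma tendsto_nome : Tendsto nome imInfty (𝓝 0) := by
  rw [tendsto_zero_iff_norm_tendsto_zero]
  simp only [norm_nome]
  refine Real.tendsto_exp_atBot.comp (Tendsto.const_mul_atTop_of_neg ?_ tendsto_comap)
  nlinarith [Real.pi_pos]

lemma hasDerivAt_nome (z : ℂ) : HasDerivAt nome (2 * Real.pi * Complex.I * nome z) z := by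
  have h := ((hasDerivAt_id z).const_mul (2 * Real.pi * Complex.I)).cexp
  refine h.congr_deriv ?_
  simp only [id, mul_one, nome]
  ring

lemma eventually_im_pos : ∀ᶠ z in imInfty, 0 < z.im :=
  tendsto_comap.eventually (eventually_gt_atTop 0)

lemma tendsto_natCast_mul {N : ℕ} (hN : 1 ≤ N) :
    Tendsto (fun z : ℂ => (N : ℂ) * z) imInfty imInfty := by
  rw [tendsto_comap_iff]
  have h : (Complex.im ∘ fun z : ℂ => (N : ℂ) * z) = fun z => (N : ℝ) * z.im := by
    ext z
    simp
  rw [h]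
  exact Tendsto.const_mul_atTop (by exact_mod_cast hN) tendsto_comap

lemma im_natCast_mul_pos {N : ℕ} (hN : 1 ≤ N) {z : ℂ} (hz : 0 < z.im) :
    0 < ((N : ℂ) * z).im := by
  have : (0 : ℝ) < N := by exact_mod_cast hN
  simpa using mul_pos this hz

lemma im_neg_one_div (z : ℂ) : (-1 / z).im = z.im / Complex.normSq z := by
  simp [neg_div]

lemma im_neg_one_div_pos {z : ℂ} (hz : 0 < z.im) : 0 < (-1 / z).im := by
  rw [im_neg_one_div]
  refine div_pos hz (Complex.normSq_pos.2 ?_)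
  rintro rfl
  simp at hz

/-- Substitute for a fundamental domain: translate, and invert as long as the height is below 1/4.
Each inversion gains a fixed factor in height, and `n` bounds how many are needed. -/
lemma exists_reduced_point {N : ℕ} (h1 : 1 ≤ N) (h3 : N ≤ 3) {u : ℂ → ℝ}
    (hT : Function.Periodic u 1) (hW : ∀ z : ℂ, 0 < z.im → u (-1 / (N * z)) = u z)
    {z : ℂ} (hz : 0 < z.im) :
    ∃ z' : ℂ, |z'.re| ≤ 1 / 2 ∧ 1 / 4 ≤ z'.im ∧ u z' = u z := by
  have key : ∀ (n : ℕ) (z : ℂ), 0 < z.im → 1 / 4 * (15 / 16 : ℝ) ^ n ≤ z.im →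
      ∃ z' : ℂ, |z'.re| ≤ 1 / 2 ∧ 1 / 4 ≤ z'.im ∧ u z' = u z := by
    intro n
    induction n with
    | zero =>
      intro z hz hn
      refine ⟨z - (round z.re : ℤ) * 1, ?_, by simpa using hn, hT.sub_int_mul_eq _⟩
      simpa using abs_sub_round z.re
    | succ n ih =>
      intro z hz hn
      set x : ℂ := z - (round z.re : ℤ) * 1 with hx
      have hux : u x = u z := hT.sub_int_mul_eq _
      have hxim : x.im = z.im := by simp [hx]
      have hxre : |x.re| ≤ 1 / 2 := by simpa [hx] using abs_sub_round z.re
      by_cases hc : 1 / 4 ≤ x.im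
      · exact ⟨x, hxre, hc, hux⟩
      · push Not at hc
        have hxpos : 0 < x.im := by rwa [hxim]
        have hNx := im_natCast_mul_pos h1 hxpos
        have hN0 : (0 : ℝ) < N := by exact_mod_cast h1
        have hN3 : (N : ℝ) ≤ 3 := by exact_mod_cast h3
        have him : (-1 / ((N : ℂ) * x)).im = x.im / (N * (x.re ^ 2 + x.im ^ 2)) := by
          rw [im_neg_one_div, Complex.normSq_apply]
          simp
          field_simp
        have hsq : x.re ^ 2 ≤ 1 / 4 := by
          rw [← sq_abs]
          nlinarith [abs_nonneg x.re]
        -- The bound is 3(1/4 + 1/16) = 15/16, so the inversion multiplies the height by at least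
        -- 16/15.
        have hD : N * (x.re ^ 2 + x.im ^ 2) ≤ 15 / 16 := by nlinarith [sq_nonneg x.re]
        have hD0 : 0 < N * (x.re ^ 2 + x.im ^ 2) := by positivity
        obtain ⟨z', a, b, c⟩ := ih (-1 / ((N : ℂ) * x)) (im_neg_one_div_pos hNx) (by
          rw [him, le_div_iff₀ hD0]
          rw [← hxim] at hn
          calc _ ≤ 1 / 4 * (15 / 16 : ℝ) ^ n * (15 / 16) := by gcongr
            _ = 1 / 4 * (15 / 16 : ℝ) ^ (n + 1) := by ring
            _ ≤ _ := hn)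
        exact ⟨z', a, b, by rw [c, hW x hxpos, hux]⟩
  obtain ⟨n, hn⟩ := exists_pow_lt_of_lt_one (show (0 : ℝ) < 4 * z.im by positivity)
    (show (15 / 16 : ℝ) < 1 by norm_num)
  exact key n z hz (by linarith)

/-- A holomorphic function on the upper half-plane whose absolute value is invariant under
`z ↦ z + 1` and `z ↦ -1 / (N z)`, and which tends to `0` at `i∞`, vanishes. -/
lemma eq_zero_of_norm_invariant {N : ℕ} (h1 : 1 ≤ N) (h3 : N ≤ 3) {u : ℂ → ℂ}
    (hd : DifferentiableOn ℂ u {z | 0 < z.im}) (hT : Function.Periodic u 1)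
    (hW : ∀ z : ℂ, 0 < z.im → ‖u (-1 / (N * z))‖ = ‖u z‖) (h0 : Tendsto u imInfty (𝓝 0))
    {z : ℂ} (hz : 0 < z.im) : u z = 0 := by
  by_contra hne
  have hT' : Function.Periodic (fun z => ‖u z‖) 1 := fun z => by simp [hT z]
  obtain ⟨Y, hY⟩ : ∃ Y : ℝ, ∀ w : ℂ, Y ≤ w.im → ‖u w‖ < ‖u z‖ := by
    have := (tendsto_zero_iff_norm_tendsto_zero.1 h0).eventually_lt_const (norm_pos_iff.2 hne)
    rw [eventually_comap] at this
    obtain ⟨Y, hY⟩ := eventually_atTop.1 this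
    exact ⟨Y, fun w hw => hY w.im hw w rfl⟩
  -- Reduction, together with the decay at the cusp, moves every point where |u| ≥ |u z| into this
  -- rectangle, so the maximum of |u| over K is global.
  set K : Set ℂ := Set.Icc (-1 / 2) (1 / 2) ×ℂ Set.Icc (1 / 4) Y with hK
  have hKc : IsCompact K := isCompact_Icc.reProdIm isCompact_Icc
  have red : ∀ w : ℂ, 0 < w.im → ‖u z‖ ≤ ‖u w‖ → ∃ w' ∈ K, ‖u w'‖ = ‖u w‖ := by
    intro w hw hzw
    obtain ⟨w', a, b, c⟩ := exists_reduced_point h1 h3 hT' hW hw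
    refine ⟨w', ?_, c⟩
    have hlt : w'.im < Y := by
      by_contra hcon
      exact absurd (hY w' (not_lt.1 hcon)) (not_lt.2 (hzw.trans c.ge))
    rw [hK, Complex.mem_reProdIm]
    exact ⟨⟨by linarith [(abs_le.1 a).1], (abs_le.1 a).2⟩, b, hlt.le⟩
  have hKpos : K ⊆ {z | 0 < z.im} := fun w hw => by
    have := (Complex.mem_reProdIm.1 hw).2.1
    simp only [Set.mem_ofPred_eq]
    linarith
  obtain ⟨w₀, hw₀, hw₀z⟩ := red z hz le_rfl
  obtain ⟨c, hc, hmax⟩ := hKc.exists_isMaxOn ⟨w₀, hw₀⟩ (hd.continuousOn.mono hKpos).norm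
  have hzc : ‖u z‖ ≤ ‖u c‖ := hw₀z ▸ hmax hw₀
  have hmax' : IsMaxOn (norm ∘ u) {z | 0 < z.im} c := by
    intro w hw
    simp only [Set.mem_ofPred_eq, Function.comp_apply]
    rcases le_total ‖u z‖ ‖u w‖ with h | h
    · obtain ⟨w', hw', e⟩ := red w hw h
      exact e ▸ hmax hw'
    · exact h.trans hzc
  have hconst := Complex.eqOn_of_isPreconnected_of_isMaxOn_norm
    (convex_halfSpace_im_gt 0).isPreconnected
    (isOpen_lt continuous_const Complex.continuous_im) hd (hKpos hc) hmax'
  -- A point so high that |u| is below |u z| there, against the constancy of u; the `max` keeps it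
  -- in the half-plane.
  have hpt : (0 : ℝ) < ((max Y 1 : ℝ) * Complex.I).im := by simp
  have hu := hconst hpt
  have hlt := hY ((max Y 1 : ℝ) * Complex.I) (by simp)
  rw [hu] at hlt
  exact absurd hlt (not_lt.2 hzc)

/-- The modular discriminant as a function on the complex plane. -/
def delta (z : ℂ) : ℂ := ModularForm.discriminant (ofComplex z)

lemma delta_ne_zero (z : ℂ) : delta z ≠ 0 := ModularForm.discriminant_ne_zero _

lemma delta_periodic : Function.Periodic delta 1 := by
  simpa using! SlashInvariantFormClass.periodic_comp_ofComplex CuspForm.discriminant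
    one_mem_strictPeriods_SL

lemma differentiableAt_comp_ofComplex {f : ℍ → ℂ} (hf : MDiff f) {z : ℂ} (hz : 0 < z.im) :
    DifferentiableAt ℂ (fun z => f (ofComplex z)) z :=
  ((UpperHalfPlane.mdifferentiable_iff.1 hf) z hz).differentiableAt
    ((isOpen_lt continuous_const Complex.continuous_im).mem_nhds hz)

lemma differentiableAt_delta {z : ℂ} (hz : 0 < z.im) : DifferentiableAt ℂ delta z :=
  differentiableAt_comp_ofComplex CuspForm.discriminant.holo' hz

lemma comp_ofComplex_neg_one_div {f : ℍ → ℂ} {k : ℕ} (hf : f ∣[(k : ℤ)] ModularGroup.S = f)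
    {z : ℂ} (hz : 0 < z.im) : f (ofComplex (-1 / z)) = z ^ k * f (ofComplex z) := by
  have hz0 : z ≠ 0 := by
    rintro rfl
    simp at hz
  have h := SlashInvariantForm.slash_S_apply f k ⟨z, hz⟩
  rw [hf] at h
  rw [ofComplex_apply_of_im_pos hz, ofComplex_apply_of_im_pos (im_neg_one_div_pos hz), h]
  have e : (⟨-1 / z, im_neg_one_div_pos hz⟩ : ℍ)
      = .mk _ (UpperHalfPlane.im_inv_neg_coe_pos ⟨z, hz⟩) := by
    ext
    simp [neg_div, inv_neg]
  rw [← e, zpow_neg, zpow_natCast]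
  change _ = z ^ k * (_ * (z ^ k)⁻¹)
  field_simp

lemma delta_neg_one_div {z : ℂ} (hz : 0 < z.im) : delta (-1 / z) = z ^ 12 * delta z :=
  comp_ofComplex_neg_one_div (k := 12) ModularForm.discriminant_S_invariant hz

/-- A lower bound for Δ at the cusp, needed because Δ will stand in a denominator. -/
lemma nome_isBigO_delta : nome =O[imInfty] delta := by
  have h := ModularForm.exp_isBigO_discriminant.comp_tendsto tendsto_comap_im_ofComplex
  refine IsBigO.trans (IsBigO.of_bound 1 ?_) h
  filter_upwards [eventually_im_pos] with z hz
  simp [norm_nome, ofComplex_apply_of_im_pos hz]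

/-- A holomorphic function with the symmetries of a form of weight `2 k` for the Fricke group of
level `N` vanishes as soon as it is `O(q)` at the cusp and `k (N + 1) < 12`. -/
theorem eq_zero_of_fricke_symmetric {N k : ℕ} (h1 : 1 ≤ N) (h3 : N ≤ 3) (hk : k * (N + 1) < 12)
    {f : ℂ → ℂ} (hd : ∀ z : ℂ, 0 < z.im → DifferentiableAt ℂ f z) (hT : Function.Periodic f 1)
    (hW : ∀ z : ℂ, 0 < z.im → ‖f (-1 / (N * z))‖ = (N * ‖z‖ ^ 2) ^ k * ‖f z‖)
    (hO : f =O[imInfty] nome) {z : ℂ} (hz : 0 < z.im) : f z = 0 := by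
  -- Numerator and denominator both have weight 24k and Δ has no zeros, so u is holomorphic with
  -- invariant absolute value.
  set u : ℂ → ℂ := fun z => f z ^ 12 / (delta z * delta (N * z)) ^ k with hu
  have hN0 : (N : ℂ) ≠ 0 := by exact_mod_cast (by omega : N ≠ 0)
  have hne : ∀ z, (delta z * delta (N * z)) ^ k ≠ 0 := fun z =>
    pow_ne_zero _ (mul_ne_zero (delta_ne_zero _) (delta_ne_zero _))
  suffices u z = 0 by
    rw [hu] at this
    simpa [hne z, div_eq_zero_iff] using! this
  refine eq_zero_of_norm_invariant h1 h3 ?_ ?_ ?_ ?_ hz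
  · intro z hz
    have hNz := im_natCast_mul_pos h1 hz
    have hdN : DifferentiableAt ℂ (fun z => delta (N * z)) z :=
      (differentiableAt_delta hNz).comp z (differentiableAt_id.const_mul (N : ℂ))
    exact (((hd z hz).pow 12).div (((differentiableAt_delta hz).mul hdN).pow k)
      (hne z)).differentiableWithinAt
  · intro z
    have : delta (N * (z + 1)) = delta (N * z) := by
      rw [mul_add]
      simpa using delta_periodic.nat_mul N (N * z)
    simp only [hu, hT z, delta_periodic z, this]
  · intro z hz
    have hNz := im_natCast_mul_pos h1 hz
    have hz0 : z ≠ 0 := by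
      rintro rfl
      simp at hz
    have e1 : delta (-1 / (N * z)) = (N * z) ^ 12 * delta (N * z) := delta_neg_one_div hNz
    have e2 : delta (N * (-1 / (N * z))) = z ^ 12 * delta z := by
      rw [← delta_neg_one_div hz]
      congr 1
      field_simp
    have hn3 : ‖z‖ ≠ 0 := norm_ne_zero_iff.2 hz0
    have hn4 : (N : ℝ) ≠ 0 := by exact_mod_cast (by omega : N ≠ 0)
    simp only [hu, norm_div, norm_pow, norm_mul, hW z hz, e1, e2, Complex.norm_natCast]
    have e3 : ((N : ℝ) * ‖z‖) ^ 12 * ‖delta (N * z)‖ * (‖z‖ ^ 12 * ‖delta z‖)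
        = (N * ‖z‖ ^ 2) ^ 12 * (‖delta z‖ * ‖delta (N * z)‖) := by ring
    have hA : (N : ℝ) * ‖z‖ ^ 2 ≠ 0 := by positivity
    rw [e3]
    generalize (N : ℝ) * ‖z‖ ^ 2 = A at hA ⊢
    rw [mul_pow, mul_pow, ← pow_mul, ← pow_mul, mul_comm k 12]
    exact mul_div_mul_left _ _ (pow_ne_zero _ hA)
  · have hO2 : (fun z => nome z ^ N) =O[imInfty] fun z => delta (N * z) := by
      have := nome_isBigO_delta.comp_tendsto (tendsto_natCast_mul h1)
      simpa only [Function.comp_def, nome_natCast_mul] using this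
    have hO3 : (fun z => ((delta z * delta (N * z)) ^ k)⁻¹)
        =O[imInfty] fun z => ((nome z * nome z ^ N) ^ k)⁻¹ :=
      IsBigO.inv_rev ((nome_isBigO_delta.mul hO2).pow k)
        (Eventually.of_forall fun z h => absurd h (pow_ne_zero _
          (mul_ne_zero (nome_ne_zero z) (pow_ne_zero _ (nome_ne_zero z)))))
    have hO4 := (hO.pow 12).mul hO3
    -- The order of u at the cusp is at least 12 - k(N + 1), positive by `hk`.
    have h5 : (fun z => nome z ^ 12 * ((nome z * nome z ^ N) ^ k)⁻¹)
        = fun z => nome z ^ (12 - k * (N + 1)) := by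
      ext z
      rw [← pow_succ', ← pow_mul, ← div_eq_mul_inv, mul_comm (N + 1) k,
        pow_sub₀ _ (nome_ne_zero z) hk.le, div_eq_mul_inv]
    rw [h5] at hO4
    refine hO4.trans_tendsto ?_
    have := tendsto_nome.pow (12 - k * (N + 1))
    rwa [zero_pow (by omega)] at this

end

end RamanujanPi

namespace RamanujanPi

noncomputable section

open Filter Topology Asymptotics
open scoped Manifold ModularForm ArithmeticFunction.sigma

/-! ### Eisenstein series of level one and Ramanujan's differential equations -/

/-- The coefficients of `1 + c ∑ σ_k(n) qⁿ`. -/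
def eisCoeff (c : ℂ) (k n : ℕ) : ℂ := if n = 0 then 1 else c * (σ k n : ℂ)

lemma polyBounded_eisCoeff (c : ℂ) (k : ℕ) : PolyBounded (eisCoeff c k) := by
  refine ⟨1 + ‖c‖, k + 1, fun n => ?_⟩
  have h1 : (1 : ℝ) ≤ ((n : ℝ) + 1) ^ (k + 1) := one_le_pow₀ (by simp)
  rw [eisCoeff]
  split_ifs with hn
  · subst hn
    simp
  · have h2 : (σ k n : ℝ) ≤ ((n : ℝ) + 1) ^ (k + 1) := by
      have : (σ k n : ℝ) ≤ (n : ℝ) ^ (k + 1) := by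
        exact_mod_cast ArithmeticFunction.sigma_le_pow_succ k n
      refine this.trans ?_
      gcongr
      linarith
    rw [norm_mul, Complex.norm_natCast]
    nlinarith [mul_le_mul_of_nonneg_left h2 (norm_nonneg c)]

/-- `E₂` as a function on the complex plane. -/
def e2 (z : ℂ) : ℂ := EisensteinSeries.E2 (ofComplex z)

/-- `E₄` as a function on the complex plane. -/
def e4 (z : ℂ) : ℂ := ModularForm.E₄ (ofComplex z)

/-- `E₆` as a function on the complex plane. -/
def e6 (z : ℂ) : ℂ := ModularForm.E₆ (ofComplex z)

lemma e2_eq_powerSum {z : ℂ} (hz : 0 < z.im) :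
    e2 z = powerSum (eisCoeff (-24) 1) (nome z) := by
  have h := EisensteinSeries.hasSum_qExpansion_E2 ⟨z, hz⟩
  rw [e2, ofComplex_apply_of_im_pos hz, ← h.tsum_eq]
  rfl

lemma E_eq_powerSum {k : ℕ} (hk : 3 ≤ k) (hk2 : Even k) {z : ℂ} (hz : 0 < z.im) :
    ModularForm.E hk (ofComplex z)
      = powerSum (eisCoeff (-(2 * k / bernoulli k : ℂ)) (k - 1)) (nome z) := by
  have h := ModularForm.hasSum_qExpansion (f := ModularForm.E hk) one_pos
    one_mem_strictPeriods_SL ⟨z, hz⟩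
  simp only [EisensteinSeries.E_qExpansion_coeff hk hk2] at h
  rw [ofComplex_apply_of_im_pos hz, ← h.tsum_eq]
  refine tsum_congr fun n => ?_
  simp [eisCoeff, nome, Function.Periodic.qParam]

lemma e4_eq_powerSum {z : ℂ} (hz : 0 < z.im) :
    e4 z = powerSum (eisCoeff 240 3) (nome z) := by
  -- Since σ₃(1) = 1, the coefficient of q identifies the constant -2k/B_k as 240, with no Bernoulli
  -- number computed.
  have h := ModularForm.E₄_qExpansion_coeff_one
  rw [EisensteinSeries.E_qExpansion_coeff _ ⟨2, rfl⟩, if_neg one_ne_zero,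
    ArithmeticFunction.sigma_one, Nat.cast_one, mul_one] at h
  rw [e4, E_eq_powerSum _ ⟨2, rfl⟩ hz, h]

lemma e6_eq_powerSum {z : ℂ} (hz : 0 < z.im) :
    e6 z = powerSum (eisCoeff (-504) 5) (nome z) := by
  have h := ModularForm.E₆_qExpansion_coeff_one
  rw [EisensteinSeries.E_qExpansion_coeff _ ⟨3, rfl⟩, if_neg one_ne_zero,
    ArithmeticFunction.sigma_one, Nat.cast_one, mul_one] at h
  rw [e6, E_eq_powerSum _ ⟨3, rfl⟩ hz, h]

lemma differentiableAt_e2 {z : ℂ} (hz : 0 < z.im) : DifferentiableAt ℂ e2 z :=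
  differentiableAt_comp_ofComplex E2_mdifferentiable hz

lemma differentiableAt_e4 {z : ℂ} (hz : 0 < z.im) : DifferentiableAt ℂ e4 z :=
  differentiableAt_comp_ofComplex ModularForm.E₄.holo' hz

lemma differentiableAt_e6 {z : ℂ} (hz : 0 < z.im) : DifferentiableAt ℂ e6 z :=
  differentiableAt_comp_ofComplex ModularForm.E₆.holo' hz

lemma periodic_e4 : Function.Periodic e4 1 := by
  simpa using! SlashInvariantFormClass.periodic_comp_ofComplex ModularForm.E₄
    one_mem_strictPeriods_SL

lemma periodic_e6 : Function.Periodic e6 1 := by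
  simpa using! SlashInvariantFormClass.periodic_comp_ofComplex ModularForm.E₆
    one_mem_strictPeriods_SL

lemma nome_add_one (z : ℂ) : nome (z + 1) = nome z := by
  simp [nome, mul_add, Complex.exp_add, Complex.exp_two_pi_mul_I]

lemma periodic_e2 : Function.Periodic e2 1 := by
  intro z
  by_cases hz : 0 < z.im
  · rw [e2_eq_powerSum hz, e2_eq_powerSum (by simpa using hz), nome_add_one]
  -- Outside the half-plane `ofComplex` takes one default value, so periodicity holds on all of ℂ.
  · rw [e2, e2, ofComplex_apply_eq_of_im_nonpos (w := z + 1) (w' := z) (by simpa using hz)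
      (by simpa using hz)]

lemma e4_neg_one_div {z : ℂ} (hz : 0 < z.im) : e4 (-1 / z) = z ^ 4 * e4 z :=
  comp_ofComplex_neg_one_div (k := 4)
    (SlashInvariantForm.slash_action_eqn ModularForm.E₄ _ ⟨ModularGroup.S, rfl⟩) hz

lemma e6_neg_one_div {z : ℂ} (hz : 0 < z.im) : e6 (-1 / z) = z ^ 6 * e6 z :=
  comp_ofComplex_neg_one_div (k := 6)
    (SlashInvariantForm.slash_action_eqn ModularForm.E₆ _ ⟨ModularGroup.S, rfl⟩) hz

lemma ne_zero_of_im_pos {z : ℂ} (hz : 0 < z.im) : z ≠ 0 := by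
  rintro rfl
  simp at hz

lemma e2_neg_one_div {z : ℂ} (hz : 0 < z.im) :
    e2 (-1 / z) = z ^ 2 * e2 z - 6 * Complex.I / Real.pi * z := by
  have hz0 := ne_zero_of_im_pos hz
  have h := SlashInvariantForm.slash_S_apply EisensteinSeries.E2 2 ⟨z, hz⟩
  have h2 := congrFun (EisensteinSeries.E2_slash_action ModularGroup.S) ⟨z, hz⟩
  have e : (⟨-1 / z, im_neg_one_div_pos hz⟩ : ℍ)
      = .mk _ (UpperHalfPlane.im_inv_neg_coe_pos ⟨z, hz⟩) := by
    ext
    simp [neg_div, inv_neg]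
  rw [h2, ← e] at h
  rw [e2, e2, ofComplex_apply_of_im_pos hz, ofComplex_apply_of_im_pos (im_neg_one_div_pos hz)]
  simp only [Pi.sub_apply, Pi.smul_apply, EisensteinSeries.D2_S, riemannZeta_two,
    smul_eq_mul] at h
  have hpi : (Real.pi : ℂ) ≠ 0 := by exact_mod_cast Real.pi_ne_zero
  change _ - _ * (_ / z) = _ * z ^ (-2 : ℤ) at h
  have hzz : z ^ (-2 : ℤ) = (z ^ 2)⁻¹ := by
    rw [zpow_neg]
    norm_cast
  rw [hzz] at h
  field_simp at h
  field_simp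
  linear_combination -h

lemma isBigO_nome {f Φ : ℂ → ℂ} (hΦ : DifferentiableAt ℂ Φ 0) (h0 : Φ 0 = 0)
    (hf : ∀ z : ℂ, 0 < z.im → f z = Φ (nome z)) : f =O[imInfty] nome := by
  have h := hΦ.isBigO_sub
  simp only [h0, sub_zero] at h
  refine (h.comp_tendsto tendsto_nome).congr' ?_ EventuallyEq.rfl
  filter_upwards [eventually_im_pos] with z hz
  simp [hf z hz]

lemma tendsto_imInfty {f Φ : ℂ → ℂ} (hΦ : DifferentiableAt ℂ Φ 0)
    (hf : ∀ z : ℂ, 0 < z.im → f z = Φ (nome z)) : Tendsto f imInfty (𝓝 (Φ 0)) := by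
  refine (hΦ.continuousAt.tendsto.comp tendsto_nome).congr' ?_
  filter_upwards [eventually_im_pos] with z hz
  simp [hf z hz]

lemma deriv_eq_powerSum {e : ℂ → ℂ} {a : ℕ → ℂ} (ha : PolyBounded a)
    (he : ∀ z : ℂ, 0 < z.im → e z = powerSum a (nome z)) {z : ℂ} (hz : 0 < z.im) :
    deriv e z = 2 * Real.pi * Complex.I * powerSum (fun n => (n : ℂ) * a n) (nome z) := by
  have hq := norm_nome_lt_one hz
  have h := (ha.hasDerivAt hq).comp z (hasDerivAt_nome z)
  have hev : e =ᶠ[𝓝 z] powerSum a ∘ nome := by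
    filter_upwards [(isOpen_lt continuous_const Complex.continuous_im).mem_nhds hz] with w hw
    exact he w hw
  rw [(h.congr_of_eventuallyEq hev).deriv, ha.powerSum_nat_mul hq]
  ring

lemma PolyBounded.differentiableAt_zero {a : ℕ → ℂ} (ha : PolyBounded a) :
    DifferentiableAt ℂ (powerSum a) 0 :=
  (ha.hasDerivAt (x := 0) (by simp)).differentiableAt

lemma powerSum_eisCoeff_zero (c : ℂ) (k : ℕ) : powerSum (eisCoeff c k) 0 = 1 := by
  simp [powerSum_zero, eisCoeff]

lemma powerSum_nat_mul_zero (a : ℕ → ℂ) : powerSum (fun n => (n : ℂ) * a n) 0 = 0 := by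
  simp [powerSum_zero]

lemma deriv_neg_one_div {e g : ℂ → ℂ} {g' z : ℂ} (hz : 0 < z.im)
    (he : ∀ z : ℂ, 0 < z.im → DifferentiableAt ℂ e z)
    (hS : ∀ z : ℂ, 0 < z.im → e (-1 / z) = g z) (hg : HasDerivAt g g' z) :
    deriv e (-1 / z) = z ^ 2 * g' := by
  have hz0 := ne_zero_of_im_pos hz
  have h1 : HasDerivAt (fun w : ℂ => -1 / w) (z ^ 2)⁻¹ z := by
    have := (hasDerivAt_inv hz0).neg
    simp only [neg_neg] at this
    refine this.congr_of_eventuallyEq (Eventually.of_forall fun w => ?_)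
    simp [neg_div]
  have h2 := (he _ (im_neg_one_div_pos hz)).hasDerivAt.comp z h1
  have h3 : HasDerivAt (e ∘ fun w : ℂ => -1 / w) g' z := by
    refine hg.congr_of_eventuallyEq ?_
    filter_upwards [(isOpen_lt continuous_const Complex.continuous_im).mem_nhds hz] with w hw
    exact hS w hw
  rw [← h2.unique h3]
  field_simp

lemma periodic_deriv {e : ℂ → ℂ} (he : Function.Periodic e 1) :
    Function.Periodic (deriv e) 1 := by
  intro z
  rw [← deriv_comp_add_const]
  congr 1
  ext w
  exact he w

lemma differentiableAt_deriv {e : ℂ → ℂ} (he : ∀ z : ℂ, 0 < z.im → DifferentiableAt ℂ e z)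
    {z : ℂ} (hz : 0 < z.im) : DifferentiableAt ℂ (deriv e) z := by
  have ho : IsOpen {z : ℂ | 0 < z.im} := isOpen_lt continuous_const Complex.continuous_im
  have : DifferentiableOn ℂ e {z : ℂ | 0 < z.im} := fun w hw => (he w hw).differentiableWithinAt
  exact (this.deriv ho z hz).differentiableAt (ho.mem_nhds hz)

lemma eq_zero_of_modular {k : ℕ} (hk : k < 6) {f : ℂ → ℂ}
    (hd : ∀ z : ℂ, 0 < z.im → DifferentiableAt ℂ f z) (hT : Function.Periodic f 1)
    (hS : ∀ z : ℂ, 0 < z.im → f (-1 / z) = z ^ (2 * k) * f z)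
    (hO : f =O[imInfty] nome) {z : ℂ} (hz : 0 < z.im) : f z = 0 := by
  refine eq_zero_of_fricke_symmetric (N := 1) (k := k) le_rfl (by norm_num) (by omega) hd hT
    (fun z hz => ?_) hO hz
  simp [hS z hz, pow_mul]

theorem deriv_e2 {z : ℂ} (hz : 0 < z.im) :
    deriv e2 z = 2 * Real.pi * Complex.I * ((e2 z ^ 2 - e4 z) / 12) := by
  rw [← sub_eq_zero]
  refine eq_zero_of_modular (k := 2) (by norm_num)
    (f := fun z => deriv e2 z - 2 * Real.pi * Complex.I * ((e2 z ^ 2 - e4 z) / 12))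
    (fun z hz => ?_) (fun z => ?_) (fun z hz => ?_) ?_ hz
  · exact (differentiableAt_deriv (fun _ => differentiableAt_e2) hz).sub
      (((((differentiableAt_e2 hz).pow 2).sub (differentiableAt_e4 hz)).div_const _).const_mul _)
  · simp only [periodic_deriv periodic_e2 z, periodic_e2 z, periodic_e4 z]
  -- The anomalous terms of E₂ cancel between the derivative and E₂², leaving pure weight 4.
  · have hd := deriv_neg_one_div hz (fun _ => differentiableAt_e2) (fun _ => e2_neg_one_div)
      (((hasDerivAt_pow 2 z).mul (differentiableAt_e2 hz).hasDerivAt).sub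
        ((hasDerivAt_id z).const_mul (6 * Complex.I / Real.pi)))
    simp only [hd, e2_neg_one_div hz, e4_neg_one_div hz]
    have hpi : (Real.pi : ℂ) ≠ 0 := by exact_mod_cast Real.pi_ne_zero
    field_simp
    ring_nf
    simp only [Complex.I_sq, Complex.I_pow_three]
    ring
  · have hb2 := polyBounded_eisCoeff (-24) 1
    have hb4 := polyBounded_eisCoeff 240 3
    refine isBigO_nome (Φ := fun x => 2 * Real.pi * Complex.I *
      powerSum (fun n => (n : ℂ) * eisCoeff (-24) 1 n) x - 2 * Real.pi * Complex.I *
      ((powerSum (eisCoeff (-24) 1) x ^ 2 - powerSum (eisCoeff 240 3) x) / 12)) ?_ ?_ ?_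
    · exact (hb2.nat_mul.differentiableAt_zero.const_mul _).sub
        ((((hb2.differentiableAt_zero.pow 2).sub hb4.differentiableAt_zero).div_const _).const_mul _)
    · simp [powerSum_eisCoeff_zero, powerSum_nat_mul_zero]
    · intro z hz
      rw [deriv_eq_powerSum hb2 (fun _ => e2_eq_powerSum) hz, e2_eq_powerSum hz,
        e4_eq_powerSum hz]

theorem deriv_e4 {z : ℂ} (hz : 0 < z.im) :
    deriv e4 z = 2 * Real.pi * Complex.I * ((e2 z * e4 z - e6 z) / 3) := by
  rw [← sub_eq_zero]
  refine eq_zero_of_modular (k := 3) (by norm_num)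
    (f := fun z => deriv e4 z - 2 * Real.pi * Complex.I * ((e2 z * e4 z - e6 z) / 3))
    (fun z hz => ?_) (fun z => ?_) (fun z hz => ?_) ?_ hz
  · exact (differentiableAt_deriv (fun _ => differentiableAt_e4) hz).sub
      (((((differentiableAt_e2 hz).mul (differentiableAt_e4 hz)).sub
        (differentiableAt_e6 hz)).div_const _).const_mul _)
  · simp only [periodic_deriv periodic_e4 z, periodic_e2 z, periodic_e4 z, periodic_e6 z]
  · have hd := deriv_neg_one_div hz (fun _ => differentiableAt_e4) (fun _ => e4_neg_one_div)
      ((hasDerivAt_pow 4 z).mul (differentiableAt_e4 hz).hasDerivAt)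
    simp only [hd, e2_neg_one_div hz, e4_neg_one_div hz, e6_neg_one_div hz]
    have hpi : (Real.pi : ℂ) ≠ 0 := by exact_mod_cast Real.pi_ne_zero
    field_simp
    ring_nf
    simp only [Complex.I_sq]
    ring
  · have hb2 := polyBounded_eisCoeff (-24) 1
    have hb4 := polyBounded_eisCoeff 240 3
    have hb6 := polyBounded_eisCoeff (-504) 5
    refine isBigO_nome (Φ := fun x => 2 * Real.pi * Complex.I *
      powerSum (fun n => (n : ℂ) * eisCoeff 240 3 n) x - 2 * Real.pi * Complex.I *
      ((powerSum (eisCoeff (-24) 1) x * powerSum (eisCoeff 240 3) x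
        - powerSum (eisCoeff (-504) 5) x) / 3)) ?_ ?_ ?_
    · exact (hb4.nat_mul.differentiableAt_zero.const_mul _).sub
        ((((hb2.differentiableAt_zero.mul hb4.differentiableAt_zero).sub
          hb6.differentiableAt_zero).div_const _).const_mul _)
    · simp [powerSum_eisCoeff_zero, powerSum_nat_mul_zero]
    · intro z hz
      rw [deriv_eq_powerSum hb4 (fun _ => e4_eq_powerSum) hz, e2_eq_powerSum hz,
        e4_eq_powerSum hz, e6_eq_powerSum hz]

theorem deriv_e6 {z : ℂ} (hz : 0 < z.im) :
    deriv e6 z = 2 * Real.pi * Complex.I * ((e2 z * e6 z - e4 z ^ 2) / 2) := by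
  rw [← sub_eq_zero]
  refine eq_zero_of_modular (k := 4) (by norm_num)
    (f := fun z => deriv e6 z - 2 * Real.pi * Complex.I * ((e2 z * e6 z - e4 z ^ 2) / 2))
    (fun z hz => ?_) (fun z => ?_) (fun z hz => ?_) ?_ hz
  · exact (differentiableAt_deriv (fun _ => differentiableAt_e6) hz).sub
      (((((differentiableAt_e2 hz).mul (differentiableAt_e6 hz)).sub
        ((differentiableAt_e4 hz).pow 2)).div_const _).const_mul _)
  · simp only [periodic_deriv periodic_e6 z, periodic_e2 z, periodic_e4 z, periodic_e6 z]
  · have hd := deriv_neg_one_div hz (fun _ => differentiableAt_e6) (fun _ => e6_neg_one_div)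
      ((hasDerivAt_pow 6 z).mul (differentiableAt_e6 hz).hasDerivAt)
    simp only [hd, e2_neg_one_div hz, e4_neg_one_div hz, e6_neg_one_div hz]
    have hpi : (Real.pi : ℂ) ≠ 0 := by exact_mod_cast Real.pi_ne_zero
    field_simp
    ring_nf
    simp only [Complex.I_sq]
    ring
  · have hb2 := polyBounded_eisCoeff (-24) 1
    have hb4 := polyBounded_eisCoeff 240 3
    have hb6 := polyBounded_eisCoeff (-504) 5
    refine isBigO_nome (Φ := fun x => 2 * Real.pi * Complex.I *
      powerSum (fun n => (n : ℂ) * eisCoeff (-504) 5 n) x - 2 * Real.pi * Complex.I *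
      ((powerSum (eisCoeff (-24) 1) x * powerSum (eisCoeff (-504) 5) x
        - powerSum (eisCoeff 240 3) x ^ 2) / 2)) ?_ ?_ ?_
    · exact (hb6.nat_mul.differentiableAt_zero.const_mul _).sub
        ((((hb2.differentiableAt_zero.mul hb6.differentiableAt_zero).sub
          (hb4.differentiableAt_zero.pow 2)).div_const _).const_mul _)
    · simp [powerSum_eisCoeff_zero, powerSum_nat_mul_zero]
    · intro z hz
      rw [deriv_eq_powerSum hb6 (fun _ => e6_eq_powerSum) hz, e2_eq_powerSum hz,
        e4_eq_powerSum hz, e6_eq_powerSum hz]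

end

end RamanujanPi

namespace RamanujanPi

noncomputable section

open Filter Topology Asymptotics

/-! ### The differential system at levels two and three -/

/-- `F₂` as a function on the complex plane. -/
def f2 (N : ℕ) (z : ℂ) : ℂ := ((N : ℂ) * e2 (N * z) - e2 z) / ((N : ℂ) - 1)

/-- `F₄` as a function on the complex plane. -/
def f4 (N : ℕ) (z : ℂ) : ℂ := ((N : ℂ) ^ 2 * e4 (N * z) - e4 z) / ((N : ℂ) ^ 2 - 1)

/-- `P₂` as a function on the complex plane. -/
def p2 (N : ℕ) (z : ℂ) : ℂ := ((N : ℂ) * e2 (N * z) + e2 z) / ((N : ℂ) + 1)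

/-- `F₄ / F₂²`, a square root of `1 - 1 / J_N`. -/
def w (N : ℕ) (z : ℂ) : ℂ := f4 N z / f2 N z ^ 2

lemma one_le_level {N : ℕ} (hN : N = 2 ∨ N = 3) : 1 ≤ N := by omega

lemma differentiableAt_comp_natCast_mul {e : ℂ → ℂ}
    (he : ∀ z : ℂ, 0 < z.im → DifferentiableAt ℂ e z) {N : ℕ} (hN : 1 ≤ N) {z : ℂ}
    (hz : 0 < z.im) : DifferentiableAt ℂ (fun z => e (N * z)) z :=
  (he _ (im_natCast_mul_pos hN hz)).comp z (differentiableAt_id.const_mul (N : ℂ))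

lemma hasDerivAt_comp_natCast_mul {e : ℂ → ℂ} {e' : ℂ} {N : ℕ} {z : ℂ}
    (he : HasDerivAt e e' (N * z)) : HasDerivAt (fun z => e (N * z)) (N * e') z := by
  have h := he.comp z ((hasDerivAt_id z).const_mul (N : ℂ))
  refine h.congr_deriv ?_
  ring

lemma periodic_comp_natCast_mul {e : ℂ → ℂ} (he : Function.Periodic e 1) (N : ℕ) :
    Function.Periodic (fun z => e (N * z)) 1 := by
  intro z
  simpa [mul_add] using he.nat_mul N (N * z)

/-- The inversion exchanges E₂(Nz) and E₂(z) up to factors, and their anomalous terms cancel in the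
difference. The sign -1 disappears in F₂². -/
lemma f2_neg_one_div {N : ℕ} (hN : 1 < N) {z : ℂ} (hz : 0 < z.im) :
    f2 N (-1 / (N * z)) = -(N * z ^ 2) * f2 N z := by
  have hz0 := ne_zero_of_im_pos hz
  have hN0 : (N : ℂ) ≠ 0 := by exact_mod_cast (by omega : N ≠ 0)
  have hN1 : (N : ℂ) - 1 ≠ 0 := sub_ne_zero.2 (by exact_mod_cast (by omega : N ≠ 1))
  have e : (N : ℂ) * (-1 / (N * z)) = -1 / z := by field_simp
  simp only [f2, e, e2_neg_one_div hz, e2_neg_one_div (im_natCast_mul_pos hN.le hz)]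
  field_simp
  ring

/-- The sum, unlike the difference F₄, has Fricke sign +1, so it can be compared with F₂². -/
lemma e4_add_neg_one_div {N : ℕ} (hN : 1 ≤ N) {z : ℂ} (hz : 0 < z.im) :
    (N : ℂ) ^ 2 * e4 (N * (-1 / (N * z))) + e4 (-1 / (N * z))
      = (N * z ^ 2) ^ 2 * ((N : ℂ) ^ 2 * e4 (N * z) + e4 z) := by
  have hz0 := ne_zero_of_im_pos hz
  have hN0 : (N : ℂ) ≠ 0 := by exact_mod_cast (by omega : N ≠ 0)
  have e : (N : ℂ) * (-1 / (N * z)) = -1 / z := by field_simp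
  rw [e, e4_neg_one_div hz, e4_neg_one_div (im_natCast_mul_pos hN hz)]
  ring

/-- The `q`-expansion of `F₂`. -/
def phi2 (N : ℕ) (x : ℂ) : ℂ :=
  ((N : ℂ) * powerSum (eisCoeff (-24) 1) (x ^ N) - powerSum (eisCoeff (-24) 1) x) / ((N : ℂ) - 1)

/-- The `q`-expansion of `F₄`. -/
def phi4 (N : ℕ) (x : ℂ) : ℂ :=
  ((N : ℂ) ^ 2 * powerSum (eisCoeff 240 3) (x ^ N) - powerSum (eisCoeff 240 3) x)
    / ((N : ℂ) ^ 2 - 1)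

lemma e2_natCast_mul {N : ℕ} (hN : 1 ≤ N) {z : ℂ} (hz : 0 < z.im) :
    e2 (N * z) = powerSum (eisCoeff (-24) 1) (nome z ^ N) := by
  rw [e2_eq_powerSum (im_natCast_mul_pos hN hz), nome_natCast_mul]

lemma e4_natCast_mul {N : ℕ} (hN : 1 ≤ N) {z : ℂ} (hz : 0 < z.im) :
    e4 (N * z) = powerSum (eisCoeff 240 3) (nome z ^ N) := by
  rw [e4_eq_powerSum (im_natCast_mul_pos hN hz), nome_natCast_mul]

lemma f2_eq_phi2 {N : ℕ} (hN : 1 ≤ N) {z : ℂ} (hz : 0 < z.im) : f2 N z = phi2 N (nome z) := by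
  rw [f2, phi2, e2_natCast_mul hN hz, e2_eq_powerSum hz]

lemma f4_eq_phi4 {N : ℕ} (hN : 1 ≤ N) {z : ℂ} (hz : 0 < z.im) : f4 N z = phi4 N (nome z) := by
  rw [f4, phi4, e4_natCast_mul hN hz, e4_eq_powerSum hz]

lemma PolyBounded.hasDerivAt_zero {a : ℕ → ℂ} (ha : PolyBounded a) :
    HasDerivAt (powerSum a) (a 1) 0 := by
  simpa [powerSum_zero] using ha.hasDerivAt (x := 0) (by simp)

lemma PolyBounded.hasDerivAt_comp_pow_zero {a : ℕ → ℂ} (ha : PolyBounded a) {N : ℕ}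
    (hN : 1 < N) : HasDerivAt (fun x => powerSum a (x ^ N)) 0 0 := by
  have h0 : HasDerivAt (powerSum a) (a 1) ((0 : ℂ) ^ N) := by
    rw [zero_pow (by omega)]
    exact ha.hasDerivAt_zero
  have h := h0.comp 0 (hasDerivAt_pow N (0 : ℂ))
  refine h.congr_deriv ?_
  rw [zero_pow (by omega)]
  simp

lemma hasDerivAt_phi2_zero {N : ℕ} (hN : 1 < N) :
    HasDerivAt (phi2 N) (24 / ((N : ℂ) - 1)) 0 := by
  have hb := polyBounded_eisCoeff (-24) 1
  have h := (((hb.hasDerivAt_comp_pow_zero hN).const_mul (N : ℂ)).sub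
    hb.hasDerivAt_zero).div_const ((N : ℂ) - 1)
  refine h.congr_deriv ?_
  simp [eisCoeff]

lemma hasDerivAt_phi4_zero {N : ℕ} (hN : 1 < N) :
    HasDerivAt (phi4 N) (-240 / ((N : ℂ) ^ 2 - 1)) 0 := by
  have hb := polyBounded_eisCoeff 240 3
  have h := (((hb.hasDerivAt_comp_pow_zero hN).const_mul ((N : ℂ) ^ 2)).sub
    hb.hasDerivAt_zero).div_const ((N : ℂ) ^ 2 - 1)
  refine h.congr_deriv ?_
  simp [eisCoeff]

lemma phi2_zero {N : ℕ} (hN : 1 < N) : phi2 N 0 = 1 := by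
  have hN1 : (N : ℂ) - 1 ≠ 0 := sub_ne_zero.2 (by exact_mod_cast (by omega : N ≠ 1))
  rw [phi2, zero_pow (by omega), powerSum_eisCoeff_zero, mul_one, div_self hN1]

lemma phi4_zero {N : ℕ} (hN : 1 < N) : phi4 N 0 = 1 := by
  have hN1 : (N : ℂ) ^ 2 - 1 ≠ 0 := by
    refine sub_ne_zero.2 ?_
    exact_mod_cast (by nlinarith : N ^ 2 ≠ 1)
  rw [phi4, zero_pow (by omega), powerSum_eisCoeff_zero, mul_one, div_self hN1]

/-- The weight four relation between `E₄` and `F₂²` at levels two and three. -/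
theorem e4_add_eq_f2_sq {N : ℕ} (hN : N = 2 ∨ N = 3) {z : ℂ} (hz : 0 < z.im) :
    (N : ℂ) ^ 2 * e4 (N * z) + e4 z = ((N : ℂ) ^ 2 + 1) * f2 N z ^ 2 := by
  have h1 : 1 < N := by omega
  rw [← sub_eq_zero]
  refine eq_zero_of_fricke_symmetric (N := N) (k := 2) h1.le (by omega) (by omega)
    (f := fun z => (N : ℂ) ^ 2 * e4 (N * z) + e4 z - ((N : ℂ) ^ 2 + 1) * f2 N z ^ 2)
    (fun z hz => ?_) (fun z => ?_) (fun z hz => ?_) ?_ hz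
  · have a := differentiableAt_comp_natCast_mul (fun _ => differentiableAt_e4) h1.le hz
    have b := differentiableAt_comp_natCast_mul (fun _ => differentiableAt_e2) h1.le hz
    exact ((a.const_mul _).add (differentiableAt_e4 hz)).sub
      (((((b.const_mul _).sub (differentiableAt_e2 hz)).div_const _).pow 2).const_mul _)
  · simp only [f2, periodic_comp_natCast_mul periodic_e4 N z, periodic_e4 z, periodic_e2 z,
      periodic_comp_natCast_mul periodic_e2 N z]
  · have e : (N : ℂ) ^ 2 * e4 (N * (-1 / (N * z))) + e4 (-1 / (N * z))
          - ((N : ℂ) ^ 2 + 1) * f2 N (-1 / (N * z)) ^ 2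
        = (N * z ^ 2) ^ 2 *
          ((N : ℂ) ^ 2 * e4 (N * z) + e4 z - ((N : ℂ) ^ 2 + 1) * f2 N z ^ 2) := by
      rw [e4_add_neg_one_div h1.le hz, f2_neg_one_div h1 hz]
      ring
    simp only [e, norm_mul, norm_pow, Complex.norm_natCast]
  · have hb4 := polyBounded_eisCoeff 240 3
    refine isBigO_nome (Φ := fun x => (N : ℂ) ^ 2 * powerSum (eisCoeff 240 3) (x ^ N)
      + powerSum (eisCoeff 240 3) x - ((N : ℂ) ^ 2 + 1) * phi2 N x ^ 2) ?_ ?_ ?_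
    · exact (((hb4.hasDerivAt_comp_pow_zero h1).differentiableAt.const_mul _).add
        hb4.differentiableAt_zero).sub
        (((hasDerivAt_phi2_zero h1).differentiableAt.pow 2).const_mul _)
    · simp [phi2_zero h1, powerSum_eisCoeff_zero, zero_pow (show N ≠ 0 by omega)]
    · intro z hz
      rw [f2_eq_phi2 h1.le hz, e4_natCast_mul h1.le hz, e4_eq_powerSum hz]

lemma hasDerivAt_e2 {z : ℂ} (hz : 0 < z.im) :
    HasDerivAt e2 (2 * Real.pi * Complex.I * ((e2 z ^ 2 - e4 z) / 12)) z :=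
  deriv_e2 hz ▸ (differentiableAt_e2 hz).hasDerivAt

lemma hasDerivAt_e4 {z : ℂ} (hz : 0 < z.im) :
    HasDerivAt e4 (2 * Real.pi * Complex.I * ((e2 z * e4 z - e6 z) / 3)) z :=
  deriv_e4 hz ▸ (differentiableAt_e4 hz).hasDerivAt

lemma hasDerivAt_e6 {z : ℂ} (hz : 0 < z.im) :
    HasDerivAt e6 (2 * Real.pi * Complex.I * ((e2 z * e6 z - e4 z ^ 2) / 2)) z :=
  deriv_e6 hz ▸ (differentiableAt_e6 hz).hasDerivAt

/-- By Ramanujan's equation for E₂ and the factorization N²E₂(Nz)² - E₂(z)² = (N² - 1)F₂P₂; this is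
where s = (N + 1)/12 arises. -/
lemma hasDerivAt_f2 {N : ℕ} (hN : 1 < N) {z : ℂ} (hz : 0 < z.im) :
    HasDerivAt (f2 N) (2 * Real.pi * Complex.I * (s N * (p2 N z * f2 N z - f4 N z))) z := by
  have hN1 : (N : ℂ) - 1 ≠ 0 := sub_ne_zero.2 (by exact_mod_cast (by omega : N ≠ 1))
  have hN2 : (N : ℂ) + 1 ≠ 0 := by exact_mod_cast (by omega : N + 1 ≠ 0)
  have hN3 : (N : ℂ) ^ 2 - 1 ≠ 0 := by
    rw [show (N : ℂ) ^ 2 - 1 = (N - 1) * (N + 1) by ring]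
    exact mul_ne_zero hN1 hN2
  have h := ((((hasDerivAt_comp_natCast_mul (hasDerivAt_e2 (im_natCast_mul_pos hN.le hz))).const_mul
    (N : ℂ)).sub (hasDerivAt_e2 hz)).div_const ((N : ℂ) - 1))
  refine h.congr_deriv ?_
  rw [s, p2, f2, f4]
  rw [show (N : ℂ) ^ 2 - 1 = (N - 1) * (N + 1) by ring] at hN3 ⊢
  field_simp
  ring

/-- Here E₄ enters through N²E₄(Nz) + E₄(z), which the weight four relation replaces by a multiple
of F₂². -/
lemma hasDerivAt_p2 {N : ℕ} (hN : N = 2 ∨ N = 3) {z : ℂ} (hz : 0 < z.im) :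
    HasDerivAt (p2 N) (2 * Real.pi * Complex.I * (s N / 2 * (p2 N z ^ 2 - f2 N z ^ 2))) z := by
  have h4 := e4_add_eq_f2_sq hN hz
  have h := ((((hasDerivAt_comp_natCast_mul (hasDerivAt_e2
    (im_natCast_mul_pos (one_le_level hN) hz))).const_mul
    (N : ℂ)).add (hasDerivAt_e2 hz)).div_const ((N : ℂ) + 1))
  refine h.congr_deriv ?_
  rw [f2] at h4
  rw [s, p2, f2]
  rcases hN with rfl | rfl
  · push_cast at h4 ⊢
    linear_combination (-2 * Real.pi * Complex.I / 36) * h4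
  · push_cast at h4 ⊢
    linear_combination (-2 * Real.pi * Complex.I / 48) * h4

lemma hasDerivAt_f4 {N : ℕ} (hN : 1 ≤ N) {z : ℂ} (hz : 0 < z.im) :
    HasDerivAt (f4 N) (2 * Real.pi * Complex.I * (((N : ℂ) ^ 3 *
      (e2 (N * z) * e4 (N * z) - e6 (N * z)) - (e2 z * e4 z - e6 z)) / 3 / ((N : ℂ) ^ 2 - 1))) z := by
  have h := ((((hasDerivAt_comp_natCast_mul (hasDerivAt_e4 (im_natCast_mul_pos hN hz))).const_mul
    ((N : ℂ) ^ 2)).sub (hasDerivAt_e4 hz)).div_const ((N : ℂ) ^ 2 - 1))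
  refine h.congr_deriv ?_
  ring

lemma eventually_im_pos_nhds {z : ℂ} (hz : 0 < z.im) : ∀ᶠ x in 𝓝 z, 0 < x.im :=
  (isOpen_lt continuous_const Complex.continuous_im).mem_nhds hz

/-- The weight six relation obtained by differentiating the weight four relation. -/
lemma e6_add_eq_f2_mul_f4 {N : ℕ} (hN : N = 2 ∨ N = 3) {z : ℂ} (hz : 0 < z.im) :
    (N : ℂ) ^ 3 * e6 (N * z) + e6 z = ((N : ℂ) ^ 3 + 1) * (f2 N z * f4 N z) := by
  have hl := ((hasDerivAt_comp_natCast_mul (hasDerivAt_e4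
    (im_natCast_mul_pos (one_le_level hN) hz))).const_mul ((N : ℂ) ^ 2)).add (hasDerivAt_e4 hz)
  have hr := ((hasDerivAt_f2 (show 1 < N by omega) hz).pow 2).const_mul ((N : ℂ) ^ 2 + 1)
  have hu := hl.unique (hr.congr_of_eventuallyEq (by
    filter_upwards [eventually_im_pos_nhds hz] with x hx
    exact e4_add_eq_f2_sq hN hx))
  have hpi : (2 * Real.pi * Complex.I : ℂ) ≠ 0 := Complex.two_pi_I_ne_zero
  refine mul_left_cancel₀ hpi ?_
  have h4 := e4_add_eq_f2_sq hN hz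
  rw [f2] at h4
  simp only [s, p2, f2, f4] at hu ⊢
  rcases hN with rfl | rfl
  · push_cast at h4 hu ⊢
    linear_combination (-3) * hu + 2 * Real.pi * Complex.I * (2 * e2 (2 * z) + e2 z) / 2 * h4
  · push_cast at h4 hu ⊢
    linear_combination (-3) * hu + 2 * Real.pi * Complex.I * (3 * e2 (3 * z) + e2 z) / 2 * h4

/-- The derivative of `F₄ / F₂²`. -/
theorem hasDerivAt_w {N : ℕ} (hN : N = 2 ∨ N = 3) {z : ℂ} (hz : 0 < z.im) (h0 : f2 N z ≠ 0) :
    HasDerivAt (w N) (2 * Real.pi * Complex.I * (-(f2 N z * (1 - w N z ^ 2)) / 2)) z := by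
  have h1 : 1 < N := by omega
  have hF := hasDerivAt_f2 h1 hz
  have hH := hasDerivAt_f4 h1.le hz
  -- DF₄ involves E₆(z) and E₆(Nz) separately. The weight six relation eliminates one of them, its
  -- derivative the other.
  have hl := ((hasDerivAt_comp_natCast_mul (hasDerivAt_e6
    (im_natCast_mul_pos (one_le_level hN) hz))).const_mul ((N : ℂ) ^ 3)).add (hasDerivAt_e6 hz)
  have hr := (hF.mul hH).const_mul ((N : ℂ) ^ 3 + 1)
  have hu := hl.unique (hr.congr_of_eventuallyEq (by
    filter_upwards [eventually_im_pos_nhds hz] with x hx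
    exact e6_add_eq_f2_mul_f4 hN hx))
  have h4 := e4_add_eq_f2_sq hN hz
  have h6 := e6_add_eq_f2_mul_f4 hN hz
  have h := hF.fun_pow 2
  refine (hH.div h (pow_ne_zero 2 h0)).congr_deriv ?_
  have hpi : (2 * Real.pi * Complex.I : ℂ) ≠ 0 := Complex.two_pi_I_ne_zero
  generalize (2 * Real.pi * Complex.I : ℂ) = κ at *
  have hP : p2 N z = ((N : ℂ) * e2 (N * z) + e2 z) / ((N : ℂ) + 1) := rfl
  have hFd : f2 N z = ((N : ℂ) * e2 (N * z) - e2 z) / ((N : ℂ) - 1) := rfl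
  have hHd : f4 N z = ((N : ℂ) ^ 2 * e4 (N * z) - e4 z) / ((N : ℂ) ^ 2 - 1) := rfl
  rw [w]
  generalize f2 N z = F at *
  generalize f4 N z = H at *
  generalize p2 N z = P at *
  generalize e2 z = A at *
  generalize e2 (N * z) = B at *
  generalize e4 z = E at *
  generalize e4 (N * z) = E' at *
  generalize e6 z = x at *
  generalize e6 (N * z) = x' at *
  rcases hN with rfl | rfl
  · push_cast at *
    have hA : A = (3 * P - 1 * F) / 2 := by rw [hP, hFd]; ring
    have hB : B = (3 * P + 1 * F) / 4 := by rw [hP, hFd]; ring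
    have hE : E = (5 * F ^ 2 - 3 * H) / 2 := by linear_combination h4 / 2 + (3 / 2) * hHd
    have hE' : E' = (5 * F ^ 2 + 3 * H) / 8 := by
      linear_combination h4 / 8 - (3 / 8) * hHd
    have hx : x = 9 * (F * H) - 8 * x' := by linear_combination h6
    clear hP hFd hHd h4 h6 hF hH h hl hr
    subst hA hB hE hE' hx
    rw [s] at hu ⊢
    push_cast at *
    generalize hDH : (_ : ℂ) / 3 / (2 ^ 2 - 1) = DH at *
    -- The numerator of the quotient rule for F₄/F₂², freed of its common factor; the derivative
    -- `DH` of F₄ is kept opaque until it is needed.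
    have key : F * DH - 2 * H * (((2 : ℂ) + 1) / 12 * (P * F - H)) + (F ^ 4 - H ^ 2) / 2 = 0 := by
      refine mul_left_cancel₀ hpi ?_
      rw [← hDH] at hu ⊢
      linear_combination (-4 / 45) * hu
    field_simp
    linear_combination 24 * key
  · push_cast at *
    have hA : A = (4 * P - 2 * F) / 2 := by rw [hP, hFd]; ring
    have hB : B = (4 * P + 2 * F) / 6 := by rw [hP, hFd]; ring
    have hE : E = (10 * F ^ 2 - 8 * H) / 2 := by linear_combination h4 / 2 + (8 / 2) * hHd
    have hE' : E' = (10 * F ^ 2 + 8 * H) / 18 := by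
      linear_combination h4 / 18 - (8 / 18) * hHd
    have hx : x = 28 * (F * H) - 27 * x' := by linear_combination h6
    clear hP hFd hHd h4 h6 hF hH h hl hr
    subst hA hB hE hE' hx
    rw [s] at hu ⊢
    push_cast at *
    generalize hDH : (_ : ℂ) / 3 / (3 ^ 2 - 1) = DH at *
    have key : F * DH - 2 * H * (((3 : ℂ) + 1) / 12 * (P * F - H)) + (F ^ 4 - H ^ 2) / 2 = 0 := by
      refine mul_left_cancel₀ hpi ?_
      rw [← hDH] at hu ⊢
      linear_combination (-1 / 40) * hu
    field_simp
    linear_combination 24 * key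

end

end RamanujanPi

namespace RamanujanPi

noncomputable section

open Filter Topology

/-! ### The hypergeometric functions -/

/-- The coefficients of `₂F₁(t/2, (1-t)/2; 1; x)`. -/
def hypCoeff (t : ℂ) (n : ℕ) : ℂ := poch (t / 2) n * poch ((1 - t) / 2) n / (n.factorial : ℂ) ^ 2

/-- The coefficients of `₃F₂(1/2, t, 1-t; 1, 1; x)`. -/
def clausenCoeff (t : ℂ) (n : ℕ) : ℂ :=
  poch (1 / 2) n * poch t n * poch (1 - t) n / (n.factorial : ℂ) ^ 3

lemma poch_zero (x : ℂ) : poch x 0 = 1 := by simp [poch]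

lemma poch_succ (x : ℂ) (n : ℕ) : poch x (n + 1) = poch x n * (x + n) :=
  ascPochhammer_succ_eval n x

lemma poch_one (n : ℕ) : poch 1 n = (n.factorial : ℂ) := ascPochhammer_eval_one ℂ n

lemma hypCoeff_zero (t : ℂ) : hypCoeff t 0 = 1 := by simp [hypCoeff, poch_zero]

lemma clausenCoeff_zero (t : ℂ) : clausenCoeff t 0 = 1 := by simp [clausenCoeff, poch_zero]

lemma hypCoeff_succ (t : ℂ) (n : ℕ) :
    ((n : ℂ) + 1) ^ 2 * hypCoeff t (n + 1)
      = ((n : ℂ) ^ 2 + n / 2 + t * (1 - t) / 4) * hypCoeff t n := by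
  have h1 : (n.factorial : ℂ) ≠ 0 := by exact_mod_cast n.factorial_ne_zero
  have h2 : (n : ℂ) + 1 ≠ 0 := by exact_mod_cast n.succ_ne_zero
  rw [hypCoeff, hypCoeff, poch_succ, poch_succ, Nat.factorial_succ]
  push_cast
  field_simp
  ring

lemma clausenCoeff_succ (t : ℂ) (n : ℕ) :
    ((n : ℂ) + 1) ^ 3 * clausenCoeff t (n + 1)
      = ((n : ℂ) + 1 / 2) * (n ^ 2 + n + t * (1 - t)) * clausenCoeff t n := by
  have h1 : (n.factorial : ℂ) ≠ 0 := by exact_mod_cast n.factorial_ne_zero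
  have h2 : (n : ℂ) + 1 ≠ 0 := by exact_mod_cast n.succ_ne_zero
  rw [clausenCoeff, clausenCoeff, poch_succ, poch_succ, poch_succ, Nat.factorial_succ]
  push_cast
  field_simp
  ring

section Bounds

variable {t : ℂ} {p : ℝ}

lemma norm_hypCoeff_succ (hp0 : 0 ≤ p) (ht : t * (1 - t) / 4 = p) (n : ℕ) :
    ((n : ℝ) + 1) ^ 2 * ‖hypCoeff t (n + 1)‖ = ((n : ℝ) ^ 2 + n / 2 + p) * ‖hypCoeff t n‖ := by
  have h := congrArg norm (hypCoeff_succ t n)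
  rw [ht] at h
  have e1 : ‖((n : ℂ) + 1) ^ 2‖ = ((n : ℝ) + 1) ^ 2 := by
    rw [show ((n : ℂ) + 1) ^ 2 = ((((n : ℝ) + 1) ^ 2 : ℝ) : ℂ) by push_cast; ring,
      Complex.norm_real, Real.norm_of_nonneg (by positivity)]
  have e2 : ‖(n : ℂ) ^ 2 + n / 2 + p‖ = (n : ℝ) ^ 2 + n / 2 + p := by
    rw [show (n : ℂ) ^ 2 + n / 2 + p = (((n : ℝ) ^ 2 + n / 2 + p : ℝ) : ℂ) by push_cast; ring,
      Complex.norm_real, Real.norm_of_nonneg (by positivity)]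
  rwa [norm_mul, norm_mul, e1, e2] at h

lemma polyBounded_hypCoeff (hp0 : 0 ≤ p) (hp1 : p ≤ 1 / 16) (ht : t * (1 - t) / 4 = p) :
    PolyBounded (hypCoeff t) := by
  refine ⟨1, 0, fun n => ?_⟩
  simp only [pow_zero, mul_one]
  induction n with
  | zero => simp [hypCoeff_zero]
  | succ n ih =>
    have h := norm_hypCoeff_succ hp0 ht n
    have hn : (0 : ℝ) ≤ n := n.cast_nonneg
    have h2 : ((n : ℝ) + 1) ^ 2 * ‖hypCoeff t (n + 1)‖ ≤ ((n : ℝ) + 1) ^ 2 * 1 := by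
      rw [h]
      calc _ ≤ ((n : ℝ) ^ 2 + n / 2 + p) * 1 := by gcongr
        _ ≤ _ := by nlinarith
    exact le_of_mul_le_mul_left h2 (by positivity)

/-- A telescoping bound, with equality at n = 0. The subtracted term is chosen so that the inductive
step reduces to (3m + 4)(m² + m/2 + p) ≤ 3m(m + 1)² for m = n + 1, which holds when p ≤ 1/16. -/
lemma sum_norm_hypCoeff_le (hp0 : 0 ≤ p) (hp1 : p ≤ 1 / 16) (ht : t * (1 - t) / 4 = p) (n : ℕ) :
    ∑ k ∈ Finset.range (n + 1), ‖hypCoeff t (k + 1)‖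
      ≤ 4 * p - 3 * ((n : ℝ) + 1) * ‖hypCoeff t (n + 1)‖ := by
  induction n with
  | zero =>
    have h := norm_hypCoeff_succ hp0 ht 0
    simp only [hypCoeff_zero, norm_one] at h
    simp at h ⊢
    linarith
  | succ n ih =>
    rw [Finset.sum_range_succ]
    have h := norm_hypCoeff_succ hp0 ht (n + 1)
    push_cast at h ⊢
    have hn : (0 : ℝ) ≤ n := n.cast_nonneg
    set a := ‖hypCoeff t (n + 1)‖
    set b := ‖hypCoeff t (n + 1 + 1)‖
    have ha : 0 ≤ a := norm_nonneg _
    suffices (3 * ((n : ℝ) + 1) + 4) * b ≤ 3 * ((n : ℝ) + 1) * a by linarith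
    have hpos : (0 : ℝ) < ((n : ℝ) + 1 + 1) ^ 2 := by positivity
    refine le_of_mul_le_mul_left ?_ hpos
    calc ((n : ℝ) + 1 + 1) ^ 2 * ((3 * ((n : ℝ) + 1) + 4) * b)
        = (3 * ((n : ℝ) + 1) + 4) * (((n : ℝ) + 1) ^ 2 + ((n : ℝ) + 1) / 2 + p) * a := by
          linear_combination (3 * ((n : ℝ) + 1) + 4) * h
      _ ≤ (((n : ℝ) + 1 + 1) ^ 2 * (3 * ((n : ℝ) + 1))) * a := by
          refine mul_le_mul_of_nonneg_right ?_ ha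
          nlinarith
      _ = _ := by ring

lemma norm_powerSum_hypCoeff_sub_one_le (hp0 : 0 ≤ p) (hp1 : p ≤ 1 / 16)
    (ht : t * (1 - t) / 4 = p) {x : ℂ} (hx : ‖x‖ < 1) :
    ‖powerSum (hypCoeff t) x - 1‖ ≤ 1 / 4 := by
  have hb := polyBounded_hypCoeff hp0 hp1 ht
  have hs := hb.summable_norm hx
  rw [powerSum, hs.of_norm.tsum_eq_zero_add, hypCoeff_zero, pow_zero, mul_one, add_sub_cancel_left]
  have hs1 := (summable_nat_add_iff 1).2 hs
  refine (norm_tsum_le_tsum_norm hs1).trans (Real.tsum_le_of_sum_range_le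
    (fun n => norm_nonneg _) (fun n => ?_))
  calc ∑ k ∈ Finset.range n, ‖hypCoeff t (k + 1) * x ^ (k + 1)‖
      ≤ ∑ k ∈ Finset.range (n + 1), ‖hypCoeff t (k + 1) * x ^ (k + 1)‖ :=
        Finset.sum_le_sum_of_subset_of_nonneg (by simp) fun _ _ _ => norm_nonneg _
    _ ≤ ∑ k ∈ Finset.range (n + 1), ‖hypCoeff t (k + 1)‖ := by
        refine Finset.sum_le_sum fun k _ => ?_
        rw [norm_mul, norm_pow]
        exact mul_le_of_le_one_right (norm_nonneg _) (pow_le_one₀ (norm_nonneg _) hx.le)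
    _ ≤ _ := sum_norm_hypCoeff_le hp0 hp1 ht n
    _ ≤ 1 / 4 := by
        have : 0 ≤ 3 * ((n : ℝ) + 1) * ‖hypCoeff t (n + 1)‖ := by positivity
        linarith

end Bounds

/-- The hypergeometric differential equation. -/
lemma hyp_ode {t : ℂ} (hb : PolyBounded (hypCoeff t)) {x : ℂ} (hx : ‖x‖ < 1) :
    (1 - x) * powerSum (fun n => (n : ℂ) * (n * hypCoeff t n)) x
      = x * (powerSum (fun n => (n : ℂ) * hypCoeff t n) x / 2
        + t * (1 - t) / 4 * powerSum (hypCoeff t) x) := by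
  have h0 := hb.hasSum hx
  have h1 := hb.nat_mul.hasSum hx
  have h2 := hb.nat_mul.nat_mul.hasSum hx
  have hl := (((h2.add (h1.div_const 2)).add (h0.mul_left (t * (1 - t) / 4))).mul_left x)
  have hr := (hasSum_nat_add_iff' 1).2 h2
  simp only [Finset.range_one, Finset.sum_singleton, Nat.cast_zero, zero_mul, sub_zero] at hr
  have e : (fun n : ℕ => ((n + 1 : ℕ) : ℂ) * (((n + 1 : ℕ) : ℂ) * hypCoeff t (n + 1)) * x ^ (n + 1))
      = fun n : ℕ => x * ((n : ℂ) * (n * hypCoeff t n) * x ^ n + (n : ℂ) * hypCoeff t n * x ^ n / 2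
        + t * (1 - t) / 4 * (hypCoeff t n * x ^ n)) := by
    ext n
    push_cast
    linear_combination x ^ (n + 1) * hypCoeff_succ t n
  rw [e] at hr
  linear_combination hr.unique hl

/-! ### Clausen's formula by formal power series -/

open PowerSeries in
/-- The Euler operator `X d/dX` on formal power series. -/
def euler (φ : PowerSeries ℂ) : PowerSeries ℂ := X * d⁄dX ℂ φ

lemma coeff_euler (φ : PowerSeries ℂ) (n : ℕ) :
    PowerSeries.coeff n (euler φ) = n * PowerSeries.coeff n φ := by
  rw [euler]
  cases n with
  | zero => simp
  | succ n =>
    rw [PowerSeries.coeff_succ_X_mul, PowerSeries.coeff_derivative]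
    push_cast
    ring

lemma euler_add (φ ψ : PowerSeries ℂ) : euler (φ + ψ) = euler φ + euler ψ := by
  simp [euler, mul_add]

lemma euler_mul (φ ψ : PowerSeries ℂ) : euler (φ * ψ) = euler φ * ψ + φ * euler ψ := by
  simp only [euler, Derivation.leibniz, smul_eq_mul]
  ring

lemma euler_C (c : ℂ) : euler (PowerSeries.C c) = 0 := by
  simp [euler]

lemma euler_X : euler PowerSeries.X = PowerSeries.X := by
  simp [euler]

/-- The formal power series of `₂F₁(t/2, (1-t)/2; 1; x)`. -/
def hypSeries (t : ℂ) : PowerSeries ℂ := PowerSeries.mk (hypCoeff t)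

open PowerSeries in
lemma euler_euler_hypSeries (t : ℂ) :
    euler (euler (hypSeries t)) = X * (euler (euler (hypSeries t))
      + C (1 / 2) * euler (hypSeries t) + C (t * (1 - t) / 4) * hypSeries t) := by
  ext n
  cases n with
  | zero => simp [coeff_euler]
  | succ n =>
    rw [coeff_succ_X_mul]
    simp only [map_add, coeff_C_mul, coeff_euler, hypSeries, coeff_mk]
    push_cast
    linear_combination hypCoeff_succ t n

-- The symmetric square of the second-order equation: θ³(u²) = 2uθ³u + 6(θu)(θ²u), reduced by the
-- equation for θ²u and its Euler derivative.
open PowerSeries in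
lemma euler_cube_hypSeries_sq (t : ℂ) :
    euler (euler (euler (hypSeries t * hypSeries t)))
      = X * (euler (euler (euler (hypSeries t * hypSeries t)))
        + C (3 / 2) * euler (euler (hypSeries t * hypSeries t))
        + C (t * (1 - t) + 1 / 2) * euler (hypSeries t * hypSeries t)
        + C (t * (1 - t) / 2) * (hypSeries t * hypSeries t)) := by
  have h2 := euler_euler_hypSeries t
  have h3 := congrArg euler h2
  simp only [euler_add, euler_mul, euler_C, euler_X] at h3 ⊢
  have c1 : (C (3 / 2) : PowerSeries ℂ) = 3 * C (1 / 2) := by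
    rw [← map_ofNat (C (R := ℂ)) 3, ← map_mul]
    norm_num
  have c2 : (C (t * (1 - t) + 1 / 2) : PowerSeries ℂ) = 4 * C (t * (1 - t) / 4) + C (1 / 2) := by
    rw [← map_ofNat (C (R := ℂ)) 4, ← map_mul, ← map_add]
    ring_nf
  have c3 : (C (t * (1 - t) / 2) : PowerSeries ℂ) = 2 * C (t * (1 - t) / 4) := by
    rw [← map_ofNat (C (R := ℂ)) 2, ← map_mul]
    ring_nf
  have c4 : (2 : PowerSeries ℂ) * C (1 / 2) = 1 := by
    rw [← map_ofNat (C (R := ℂ)) 2, ← map_mul]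
    norm_num
  rw [c1, c2, c3]
  generalize (C (1 / 2) : PowerSeries ℂ) = c at *
  generalize (C (t * (1 - t) / 4) : PowerSeries ℂ) = d at *
  generalize euler (euler (euler (hypSeries t))) = u3 at *
  generalize euler (euler (hypSeries t)) = u2 at *
  generalize euler (hypSeries t) = u1 at *
  generalize hypSeries t = u at *
  linear_combination 6 * u1 * h2 + 2 * u * h3 - 2 * u * u2 * X * c4

/-- Clausen's identity for the coefficients. -/
lemma coeff_hypSeries_sq (t : ℂ) (n : ℕ) :
    PowerSeries.coeff n (hypSeries t * hypSeries t) = clausenCoeff t n := by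
  induction n with
  | zero => simp [hypSeries, PowerSeries.coeff_mul, hypCoeff_zero, clausenCoeff_zero]
  | succ n ih =>
    -- The third-order equation for the square is a first-order recursion on its coefficients, the
    -- one satisfied by `clausenCoeff`.
    have h := congrArg (PowerSeries.coeff (n + 1)) (euler_cube_hypSeries_sq t)
    rw [PowerSeries.coeff_succ_X_mul] at h
    simp only [LinearMap.map_add, PowerSeries.coeff_C_mul, coeff_euler, ih] at h
    push_cast at h
    have h2 : ((n : ℂ) + 1) ^ 3 ≠ 0 := pow_ne_zero _ (by exact_mod_cast n.succ_ne_zero)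
    refine mul_left_cancel₀ h2 ?_
    rw [clausenCoeff_succ]
    linear_combination h

lemma PolyBounded.hasSum_mul {a b : ℕ → ℂ} (ha : PolyBounded a) (hb : PolyBounded b) {x : ℂ}
    (hx : ‖x‖ < 1) :
    HasSum (fun n => PowerSeries.coeff n (PowerSeries.mk a * PowerSeries.mk b) * x ^ n)
      (powerSum a x * powerSum b x) := by
  have hsa := ha.summable_norm hx
  have hsb := hb.summable_norm hx
  have h := (summable_norm_sum_mul_antidiagonal_of_summable_norm hsa hsb).of_norm.hasSum
  rw [← tsum_mul_tsum_eq_tsum_sum_antidiagonal_of_summable_norm hsa hsb] at h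
  refine h.congr_fun fun n => ?_
  rw [PowerSeries.coeff_mul, Finset.sum_mul]
  refine Finset.sum_congr rfl fun i hi => ?_
  rw [← Finset.HasAntidiagonal.mem_antidiagonal.1 hi, pow_add]
  simp only [PowerSeries.coeff_mk]
  ring

lemma hasSum_clausenCoeff {t : ℂ} (hb : PolyBounded (hypCoeff t)) {x : ℂ} (hx : ‖x‖ < 1) :
    HasSum (fun n => clausenCoeff t n * x ^ n) (powerSum (hypCoeff t) x ^ 2) := by
  rw [sq]
  refine (hb.hasSum_mul hb hx).congr_fun fun n => ?_
  rw [← coeff_hypSeries_sq, hypSeries]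

/-- The Leibniz rule θ(y²) = 2yθy, read on coefficients. -/
lemma hasSum_nat_mul_clausenCoeff {t : ℂ} (hb : PolyBounded (hypCoeff t)) {x : ℂ}
    (hx : ‖x‖ < 1) :
    HasSum (fun n : ℕ => (n : ℂ) * clausenCoeff t n * x ^ n)
      (2 * powerSum (hypCoeff t) x * powerSum (fun n => (n : ℂ) * hypCoeff t n) x) := by
  rw [mul_assoc]
  refine ((hb.hasSum_mul hb.nat_mul hx).mul_left 2).congr_fun fun n => ?_
  have e : PowerSeries.mk (fun n => (n : ℂ) * hypCoeff t n) = euler (hypSeries t) := by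
    ext n
    simp [coeff_euler, hypSeries]
  rw [← coeff_hypSeries_sq, ← coeff_euler, euler_mul, e, map_add, mul_comm (euler _)]
  simp only [hypSeries]
  ring

lemma ordinaryHypergeometric_eq_powerSum (t x : ℂ) :
    ordinaryHypergeometric (t / 2) ((1 - t) / 2) (1 : ℂ) x = powerSum (hypCoeff t) x := by
  rw [ordinaryHypergeometric_eq_tsum]
  refine tsum_congr fun n => ?_
  have h1 : (n.factorial : ℂ) ≠ 0 := by exact_mod_cast n.factorial_ne_zero
  rw [hypCoeff, poch, poch, ascPochhammer_eval_one, smul_eq_mul]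
  field_simp

end

end RamanujanPi

namespace RamanujanPi

noncomputable section

open Filter Topology

/-! ### Uniformization along vertical rays -/

/-- The hypergeometric function `₂F₁(s/2, (1-s)/2; 1; ·)` at `1 / J_N`. -/
def hypJ (N : ℕ) (z : ℂ) : ℂ := powerSum (hypCoeff (s N)) (1 - w N z ^ 2)

/-- The Euler derivative of `₂F₁(s/2, (1-s)/2; 1; ·)` at `1 / J_N`. -/
def eulerHypJ (N : ℕ) (z : ℂ) : ℂ :=
  powerSum (fun n => (n : ℂ) * hypCoeff (s N) n) (1 - w N z ^ 2)

/-- The logarithmic derivative of `F₂ ^ (1/2)`, divided by `2 π i F₂`. -/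
def riccati (N : ℕ) (z : ℂ) : ℂ := s N / 2 * (p2 N z / f2 N z - w N z)

lemma exists_real_param {N : ℕ} (hN : N = 2 ∨ N = 3) :
    ∃ p : ℝ, 0 ≤ p ∧ p ≤ 1 / 16 ∧ s N * (1 - s N) / 4 = p := by
  rcases hN with rfl | rfl
  · exact ⟨3 / 64, by norm_num, by norm_num, by norm_num [s]⟩
  · exact ⟨1 / 18, by norm_num, by norm_num, by norm_num [s]⟩

lemma polyBounded_hypCoeff_s {N : ℕ} (hN : N = 2 ∨ N = 3) : PolyBounded (hypCoeff (s N)) := by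
  obtain ⟨p, h0, h1, h⟩ := exists_real_param hN
  exact polyBounded_hypCoeff h0 h1 h

section Derivatives

variable {N : ℕ} {z : ℂ}

lemma hasDerivAt_one_sub_w_sq (hN : N = 2 ∨ N = 3) (hz : 0 < z.im) (h0 : f2 N z ≠ 0) :
    HasDerivAt (fun z => 1 - w N z ^ 2)
      (2 * Real.pi * Complex.I * ((1 - w N z ^ 2) * (w N z * f2 N z))) z := by
  refine (((hasDerivAt_w hN hz h0).fun_pow 2).const_sub 1).congr_deriv ?_
  push_cast
  ring

lemma hasDerivAt_comp_one_sub_w_sq (hN : N = 2 ∨ N = 3) (hz : 0 < z.im) (h0 : f2 N z ≠ 0)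
    (hx : ‖1 - w N z ^ 2‖ < 1) {a : ℕ → ℂ} (ha : PolyBounded a) :
    HasDerivAt (fun z => powerSum a (1 - w N z ^ 2)) (2 * Real.pi * Complex.I *
      (f2 N z * (w N z * powerSum (fun n => (n : ℂ) * a n) (1 - w N z ^ 2)))) z := by
  refine ((ha.hasDerivAt hx).comp z (hasDerivAt_one_sub_w_sq hN hz h0)).congr_deriv ?_
  rw [ha.powerSum_nat_mul hx]
  ring

lemma hasDerivAt_hypJ (hN : N = 2 ∨ N = 3) (hz : 0 < z.im) (h0 : f2 N z ≠ 0)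
    (hx : ‖1 - w N z ^ 2‖ < 1) :
    HasDerivAt (hypJ N) (2 * Real.pi * Complex.I * (f2 N z * (w N z * eulerHypJ N z))) z :=
  hasDerivAt_comp_one_sub_w_sq hN hz h0 hx (polyBounded_hypCoeff_s hN)

/-- With x = 1 - w², the derivative of the factor w cancels the θy/2 term of the hypergeometric
equation, so the pair (y, wθy) satisfies a system without a diagonal term. -/
lemma hasDerivAt_w_mul_eulerHypJ (hN : N = 2 ∨ N = 3) (hz : 0 < z.im) (h0 : f2 N z ≠ 0)
    (hx : ‖1 - w N z ^ 2‖ < 1) :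
    HasDerivAt (fun z => w N z * eulerHypJ N z) (2 * Real.pi * Complex.I *
      (f2 N z * ((1 - w N z ^ 2) * (s N * (1 - s N) / 4) * hypJ N z))) z := by
  have hb := polyBounded_hypCoeff_s hN
  refine ((hasDerivAt_w hN hz h0).mul
    (hasDerivAt_comp_one_sub_w_sq hN hz h0 hx hb.nat_mul)).congr_deriv ?_
  have h := hyp_ode hb hx
  rw [hypJ]
  linear_combination 2 * Real.pi * Complex.I * f2 N z * h

lemma hasDerivAt_f2_riccati (hN : N = 2 ∨ N = 3) (hz : 0 < z.im) (h0 : f2 N z ≠ 0) :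
    HasDerivAt (f2 N) (2 * Real.pi * Complex.I * (2 * riccati N z * f2 N z ^ 2)) z := by
  refine (hasDerivAt_f2 (by omega) hz).congr_deriv ?_
  rw [riccati, w]
  field_simp

/-- The Riccati form of the system satisfied by (y, wθy): it says that (√F₂, r√F₂) is another
solution. -/
lemma hasDerivAt_riccati (hN : N = 2 ∨ N = 3) (hz : 0 < z.im) (h0 : f2 N z ≠ 0) :
    HasDerivAt (riccati N) (2 * Real.pi * Complex.I *
      (f2 N z * ((1 - w N z ^ 2) * (s N * (1 - s N) / 4) - riccati N z ^ 2))) z := by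
  refine ((((hasDerivAt_p2 hN hz).div (hasDerivAt_f2_riccati hN hz h0) h0).sub
    (hasDerivAt_w hN hz h0)).const_mul (s N / 2)).congr_deriv ?_
  rw [riccati]
  generalize w N z = w
  field_simp
  ring

end Derivatives

/-- Differentiability is used only at points of the ray, so the region need not be connected or
simply connected. -/
lemma eq_of_tendsto_ray {G : ℂ → ℂ} {z L : ℂ}
    (h : ∀ t : ℝ, 0 ≤ t → HasDerivAt G 0 (z + t * Complex.I))
    (hL : Tendsto G imInfty (𝓝 L)) : G z = L := by
  have hd : ∀ t : ℝ, 0 ≤ t → HasDerivAt (fun t : ℝ => G (z + t * Complex.I)) 0 t := by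
    intro t ht
    have h1 : HasDerivAt (fun t : ℝ => z + t * Complex.I) (1 * Complex.I) t :=
      ((hasDerivAt_id t).ofReal_comp.mul_const Complex.I).const_add z
    exact ((h t ht).comp t h1).congr_deriv (zero_mul _)
  have hc : ∀ t : ℝ, 0 ≤ t → G (z + t * Complex.I) = G z := by
    intro t ht
    have := constant_of_has_deriv_right_zero (a := 0) (b := t)
      (f := fun t : ℝ => G (z + t * Complex.I))
      (fun r hr => (hd r hr.1).continuousAt.continuousWithinAt)
      (fun r hr => (hd r hr.1).hasDerivWithinAt) t ⟨ht, le_rfl⟩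
    simpa using this
  have ht : Tendsto (fun t : ℝ => z + t * Complex.I) atTop imInfty := by
    rw [tendsto_comap_iff]
    have : (Complex.im ∘ fun t : ℝ => z + t * Complex.I) = fun t => z.im + t := by
      ext t
      simp
    rw [this]
    exact tendsto_atTop_add_const_left _ _ tendsto_id
  refine tendsto_nhds_unique (tendsto_const_nhds.congr' ?_) (hL.comp ht)
  filter_upwards [eventually_ge_atTop 0] with t ht
  exact (hc t ht).symm

section Limits

variable {N : ℕ}

lemma tendsto_f2 (hN : 1 < N) : Tendsto (f2 N) imInfty (𝓝 1) := by
  simpa [phi2_zero hN] using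
    tendsto_imInfty (hasDerivAt_phi2_zero hN).differentiableAt fun _ => f2_eq_phi2 hN.le

lemma tendsto_f4 (hN : 1 < N) : Tendsto (f4 N) imInfty (𝓝 1) := by
  simpa [phi4_zero hN] using
    tendsto_imInfty (hasDerivAt_phi4_zero hN).differentiableAt fun _ => f4_eq_phi4 hN.le

lemma tendsto_e2 : Tendsto e2 imInfty (𝓝 1) := by
  simpa [powerSum_eisCoeff_zero] using
    tendsto_imInfty (polyBounded_eisCoeff (-24) 1).differentiableAt_zero fun _ => e2_eq_powerSum

lemma tendsto_p2 (hN : 1 ≤ N) : Tendsto (p2 N) imInfty (𝓝 1) := by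
  have h := (((tendsto_e2.comp (tendsto_natCast_mul hN)).const_mul (N : ℂ)).add
    tendsto_e2).div_const ((N : ℂ) + 1)
  have hN2 : (N : ℂ) + 1 ≠ 0 := by exact_mod_cast (by omega : N + 1 ≠ 0)
  rw [mul_one, div_self hN2] at h
  exact h

lemma tendsto_w (hN : 1 < N) : Tendsto (w N) imInfty (𝓝 1) := by
  have h := (tendsto_f4 hN).div ((tendsto_f2 hN).pow 2) (by norm_num)
  rw [one_pow, div_one] at h
  exact h

lemma tendsto_powerSum_one_sub_w_sq (hN : 1 < N) {a : ℕ → ℂ} (ha : PolyBounded a) :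
    Tendsto (fun z => powerSum a (1 - w N z ^ 2)) imInfty (𝓝 (a 0)) := by
  have h : Tendsto (fun z => 1 - w N z ^ 2) imInfty (𝓝 0) := by
    have := ((tendsto_w hN).pow 2).const_sub (1 : ℂ)
    simpa using this
  have h2 := ha.differentiableAt_zero.continuousAt.tendsto.comp h
  rwa [powerSum_zero] at h2

lemma tendsto_hypJ (hN : N = 2 ∨ N = 3) : Tendsto (hypJ N) imInfty (𝓝 1) := by
  have h := tendsto_powerSum_one_sub_w_sq (N := N) (by omega) (polyBounded_hypCoeff_s hN)
  rwa [hypCoeff_zero] at h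

lemma tendsto_eulerHypJ (hN : N = 2 ∨ N = 3) : Tendsto (eulerHypJ N) imInfty (𝓝 0) := by
  have h := tendsto_powerSum_one_sub_w_sq (N := N) (by omega) (polyBounded_hypCoeff_s hN).nat_mul
  simpa using! h

lemma tendsto_riccati (hN : N = 2 ∨ N = 3) : Tendsto (riccati N) imInfty (𝓝 0) := by
  have h := (((tendsto_p2 (one_le_level hN)).div (tendsto_f2 (N := N) (by omega)) one_ne_zero).sub
    (tendsto_w (N := N) (by omega))).const_mul (s N / 2)
  simpa using! h

end Limits

/-- The vertical ray going up from `z` stays in the upper half-plane, where `F₂ ≠ 0` and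
`|1 / J_N| < 1`. -/
def GoodRay (N : ℕ) (z : ℂ) : Prop :=
  ∀ t : ℝ, 0 ≤ t → 0 < (z + t * Complex.I).im ∧ f2 N (z + t * Complex.I) ≠ 0 ∧
    ‖1 - w N (z + t * Complex.I) ^ 2‖ < 1

lemma GoodRay.shift {N : ℕ} {z : ℂ} (h : GoodRay N z) {t : ℝ} (ht : 0 ≤ t) :
    GoodRay N (z + t * Complex.I) := by
  intro r hr
  have := h (t + r) (by positivity)
  rw [show z + ((t + r : ℝ) : ℂ) * Complex.I = z + t * Complex.I + r * Complex.I by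
    push_cast; ring] at this
  exact this

lemma GoodRay.self {N : ℕ} {z : ℂ} (h : GoodRay N z) :
    0 < z.im ∧ f2 N z ≠ 0 ∧ ‖1 - w N z ^ 2‖ < 1 := by
  simpa using h 0 le_rfl

lemma GoodRay.w_mul_eulerHypJ {N : ℕ} (hN : N = 2 ∨ N = 3) {z : ℂ} (h : GoodRay N z) :
    w N z * eulerHypJ N z = riccati N z * hypJ N z := by
  -- The square of the Wronskian of the two solutions; squaring avoids a choice of √F₂.
  have key : f2 N z * (w N z * eulerHypJ N z - riccati N z * hypJ N z) ^ 2 = 0 := by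
    refine eq_of_tendsto_ray
      (G := fun z => f2 N z * (w N z * eulerHypJ N z - riccati N z * hypJ N z) ^ 2)
      (fun t ht => ?_) ?_
    · obtain ⟨hz, h0, hx⟩ := h t ht
      generalize z + t * Complex.I = y at hz h0 hx
      refine ((hasDerivAt_f2_riccati hN hz h0).mul
        (((hasDerivAt_w_mul_eulerHypJ hN hz h0 hx).sub
          ((hasDerivAt_riccati hN hz h0).mul (hasDerivAt_hypJ hN hz h0 hx))).fun_pow
            2)).congr_deriv ?_
      simp only [Pi.sub_apply, Pi.mul_apply]
      push_cast
      ring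
    · have hl := (tendsto_f2 (N := N) (by omega)).mul
        ((((tendsto_w (N := N) (by omega)).mul (tendsto_eulerHypJ hN)).sub
          ((tendsto_riccati hN).mul (tendsto_hypJ hN))).pow 2)
      simpa using hl
  have h0 := h.self.2.1
  simpa [h0, sub_eq_zero] using key

/-- Once wθy = ry, both y² and F₂ have logarithmic derivative 2rF₂ under D, so their ratio is
constant on the ray and equals its limit 1. -/
theorem GoodRay.hypJ_sq {N : ℕ} (hN : N = 2 ∨ N = 3) {z : ℂ} (h : GoodRay N z) :
    hypJ N z ^ 2 = f2 N z := by
  have key : hypJ N z ^ 2 / f2 N z = 1 := by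
    refine eq_of_tendsto_ray (G := fun z => hypJ N z ^ 2 / f2 N z) (fun t ht => ?_) ?_
    · have hr := (h.shift ht).w_mul_eulerHypJ hN
      obtain ⟨hz, h0, hx⟩ := h t ht
      generalize z + t * Complex.I = y at hz h0 hx hr
      refine (((hasDerivAt_hypJ hN hz h0 hx).fun_pow 2).div
        (hasDerivAt_f2_riccati hN hz h0) h0).congr_deriv ?_
      rw [hr]
      field_simp
      push_cast
      ring
    · have hl := ((tendsto_hypJ hN).pow 2).div (tendsto_f2 (N := N) (by omega)) one_ne_zero
      simpa using! hl
  exact (div_eq_one_iff_eq h.self.2.1).1 key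

/-! ### The region around the cusp -/

lemma F2_eq_f2 (N : ℕ) (τ : ℍ) : F2 N τ = f2 N τ := by
  simp only [F2, f2, e2, scale, ofComplex_apply]

lemma F4_eq_f4 (N : ℕ) (τ : ℍ) : F4 N τ = f4 N τ := by
  simp only [F4, f4, e4, scale, ofComplex_apply]

lemma P2_eq_p2 (N : ℕ) (τ : ℍ) : P2 N τ = p2 N τ := by
  simp only [P2, p2, e2, scale, ofComplex_apply]

/-- All degenerate cases have |J_N| ≤ 1: a zero of F₂ gives J_N = 0, so does a zero denominator by
the convention for division by 0, and F₄ = 0 with F₂ ≠ 0 gives J_N = 1. -/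
lemma of_one_lt_norm_JN {N : ℕ} {τ : ℍ} (h : 1 < ‖JN N τ‖) :
    f2 N τ ≠ 0 ∧ f4 N τ ≠ 0 ∧ 1 / JN N τ = 1 - w N τ ^ 2 ∧ ‖1 - w N τ ^ 2‖ < 1 := by
  have hJ0 : JN N τ ≠ 0 := by
    intro h0
    rw [h0, norm_zero] at h
    linarith
  have hF : f2 N τ ≠ 0 := by
    intro h0
    apply hJ0
    rw [JN, F2_eq_f2, h0]
    simp
  have hD : f2 N τ ^ 4 - f4 N τ ^ 2 ≠ 0 := by
    intro h0
    apply hJ0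
    rw [JN, F2_eq_f2, F4_eq_f4, h0, div_zero]
  have hH : f4 N τ ≠ 0 := by
    intro h0
    rw [JN, F2_eq_f2, F4_eq_f4, h0] at h
    simp [hF] at h
  have he : 1 / JN N τ = 1 - w N τ ^ 2 := by
    rw [JN, F2_eq_f2, F4_eq_f4, w]
    field_simp
  refine ⟨hF, hH, he, ?_⟩
  rw [← he, norm_div, norm_one]
  exact (div_lt_one (by linarith)).2 h

lemma goodRay_of_mem {N : ℕ} {τ : ℍ} (h : τ ∈ cuspRegion N) : GoodRay N τ := by
  intro t ht
  have him : 0 < ((τ : ℂ) + t * Complex.I).im := by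
    have := τ.im_pos
    simp only [Complex.add_im, Complex.mul_im, Complex.ofReal_re, Complex.I_im, Complex.ofReal_im,
      Complex.I_re, coe_im]
    linarith
  have h1 : 1 < ‖JN N ⟨(τ : ℂ) + t * Complex.I, him⟩‖ := by
    refine h _ ?_ ?_
    · rw [← coe_re]
      simp
    · rw [← coe_im, ← coe_im]
      simpa using ht
  obtain ⟨a, -, -, d⟩ := of_one_lt_norm_JN h1
  exact ⟨him, a, d⟩

lemma one_lt_norm_JN_of_mem {N : ℕ} {τ : ℍ} (h : τ ∈ cuspRegion N) : 1 < ‖JN N τ‖ :=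
  h τ rfl le_rfl

lemma eventually_one_lt_norm {N : ℕ} (hN : N = 2 ∨ N = 3) :
    ∀ᶠ z in imInfty, 1 < ‖f2 N z ^ 4 / (f2 N z ^ 4 - f4 N z ^ 2)‖ := by
  have h1 : 1 < N := by omega
  -- The coefficient of q in F₂⁴ - F₄² is 96/(N - 1) + 480/(N² - 1), that is 256 or 108. Hence the
  -- denominator of J_N is nonzero near the cusp and J_N avoids its default value 0.
  have hd := ((hasDerivAt_phi2_zero h1).fun_pow 4).sub ((hasDerivAt_phi4_zero h1).fun_pow 2)
  have hne := hd.eventually_ne (c := 0) (by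
    simp only [phi2_zero h1, phi4_zero h1]
    rcases hN with rfl | rfl <;> norm_num)
  have ht : Tendsto nome imInfty (𝓝[≠] 0) :=
    tendsto_nhdsWithin_iff.2 ⟨tendsto_nome, Eventually.of_forall nome_ne_zero⟩
  have hlim : Tendsto (fun z => ‖f2 N z ^ 4‖ - ‖f2 N z ^ 4 - f4 N z ^ 2‖) imInfty (𝓝 1) := by
    have := ((tendsto_f2 h1).pow 4).norm.sub
      (((tendsto_f2 h1).pow 4).sub ((tendsto_f4 h1).pow 2)).norm
    simpa using this
  filter_upwards [ht.eventually hne, hlim.eventually_const_lt zero_lt_one, eventually_im_pos]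
    with z hz hz2 hz3
  have hz' : f2 N z ^ 4 - f4 N z ^ 2 ≠ 0 := by
    rw [f2_eq_phi2 h1.le hz3, f4_eq_phi4 h1.le hz3]
    exact hz
  rw [norm_div, one_lt_div (norm_pos_iff.2 hz')]
  linarith

lemma exists_forall_mem_cuspRegion {N : ℕ} (hN : N = 2 ∨ N = 3) :
    ∃ Y : ℝ, ∀ τ : ℍ, Y < τ.im → τ ∈ cuspRegion N := by
  have h := eventually_one_lt_norm hN
  rw [eventually_comap] at h
  obtain ⟨Y, hY⟩ := eventually_atTop.1 h
  refine ⟨Y, fun τ hτ τ' _ him => ?_⟩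
  rw [JN, F2_eq_f2, F4_eq_f4]
  exact hY τ'.im (hτ.le.trans him) τ' rfl

section Region

variable {N : ℕ} {τ : ℍ}

lemma F2_eq_powerSum_sq (hN : N = 2 ∨ N = 3) (h : τ ∈ cuspRegion N) :
    F2 N τ = powerSum (hypCoeff (s N)) (1 / JN N τ) ^ 2 := by
  obtain ⟨-, -, he, -⟩ := of_one_lt_norm_JN (one_lt_norm_JN_of_mem h)
  rw [F2_eq_f2, ← (goodRay_of_mem h).hypJ_sq hN, hypJ, he]

/-- The bound |y - 1| ≤ 1/4 gives Re y > 0, so y is the principal root of y² = F₂. -/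
lemma F2_cpow_half (hN : N = 2 ∨ N = 3) (h : τ ∈ cuspRegion N) :
    F2 N τ ^ (1 / 2 : ℂ)
      = ordinaryHypergeometric (s N / 2) ((1 - s N) / 2) (1 : ℂ) (1 / JN N τ) := by
  obtain ⟨-, -, he, hlt⟩ := of_one_lt_norm_JN (one_lt_norm_JN_of_mem h)
  obtain ⟨p, hp0, hp1, hp⟩ := exists_real_param hN
  rw [← he] at hlt
  have hb := norm_powerSum_hypCoeff_sub_one_le hp0 hp1 hp hlt
  rw [F2_eq_powerSum_sq hN h, ordinaryHypergeometric_eq_powerSum, one_div (2 : ℂ)]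
  refine Complex.sq_cpow_two_inv ?_
  have h3 := (Complex.abs_re_le_norm _).trans hb
  rw [Complex.sub_re, Complex.one_re] at h3
  linarith [(abs_le.1 h3).1]

lemma hasSum_clausen_F2 (hN : N = 2 ∨ N = 3) (h : τ ∈ cuspRegion N) :
    HasSum (fun n => clausenCoeff (s N) n * (1 / JN N τ) ^ n) (F2 N τ) := by
  obtain ⟨-, -, he, hlt⟩ := of_one_lt_norm_JN (one_lt_norm_JN_of_mem h)
  rw [F2_eq_powerSum_sq hN h]
  exact hasSum_clausenCoeff (polyBounded_hypCoeff_s hN) (he ▸ hlt)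

/-- The sum is 2yθy; multiplied by w it becomes 2ry² = 2rF₂, and w ≠ 0 because F₄ ≠ 0. -/
lemma hasSum_nat_mul_clausen (hN : N = 2 ∨ N = 3) (h : τ ∈ cuspRegion N) :
    HasSum (fun n : ℕ => (n : ℂ) * clausenCoeff (s N) n * (1 / JN N τ) ^ n)
      (s N * (P2 N τ * F2 N τ ^ 2 / F4 N τ - F2 N τ)) := by
  obtain ⟨hF, hH, he, hlt⟩ := of_one_lt_norm_JN (one_lt_norm_JN_of_mem h)
  have hs := hasSum_nat_mul_clausenCoeff (polyBounded_hypCoeff_s hN) hlt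
  rw [he]
  convert! hs using 1
  have h1 := (goodRay_of_mem h).hypJ_sq hN
  have h2 := (goodRay_of_mem h).w_mul_eulerHypJ hN
  rw [F2_eq_f2, F4_eq_f4, P2_eq_p2]
  change _ = 2 * hypJ N τ * eulerHypJ N τ
  have hw : w N τ ≠ 0 := div_ne_zero hH (pow_ne_zero 2 hF)
  refine mul_left_cancel₀ hw ?_
  have h3 : w N τ * (s N * (p2 N τ * f2 N τ ^ 2 / f4 N τ - f2 N τ))
      = 2 * riccati N τ * f2 N τ := by
    rw [riccati, w]
    field_simp
  rw [h3]
  linear_combination (-2 * riccati N τ) * h1 - 2 * hypJ N τ * h2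

/-- The general Ramanujan-type series for `1 / π` attached to level `N`. -/
lemma hasSum_ramanujan (hN : N = 2 ∨ N = 3) (h : τ ∈ cuspRegion N) :
    HasSum (fun n : ℕ => ((n : ℂ) / s N + 1 - P2star N τ * F2 N τ / F4 N τ)
        * (clausenCoeff (s N) n / JN N τ ^ n))
      (6 / (((N : ℂ) + 1) * (Real.pi : ℂ) * (τ.im : ℂ)) * (F2 N τ ^ 2 / F4 N τ)) := by
  have hs0 : s N ≠ 0 := by
    rcases hN with rfl | rfl <;> norm_num [s]
  have hs := ((hasSum_nat_mul_clausen hN h).div_const (s N)).add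
    ((hasSum_clausen_F2 hN h).mul_left (1 - P2star N τ * F2 N τ / F4 N τ))
  -- The terms ±F₂ cancel, leaving (P₂ - P₂*)F₂²/F₄.
  convert! hs using 1
  · ext n
    rw [one_div, inv_pow]
    ring
  · rw [P2star, mul_div_cancel_left₀ _ hs0]
    ring

end Region

/-! ### The products R_n(d) as Clausen coefficients, and the final assembly -/

lemma R_two (n : ℕ) : R n 2 = poch (1 / 2) n / (n.factorial : ℂ) := by
  rw [R, show (Finset.Icc 1 2).filter (fun i => Nat.gcd i 2 = 1) = {1} by decide]
  simp

lemma R_two_mul_R_three (n : ℕ) : R n 2 * R n 3 = clausenCoeff (s 3) n := by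
  rw [R_two, R, show (Finset.Icc 1 3).filter (fun i => Nat.gcd i 3 = 1) = {1, 2} by decide,
    Finset.prod_pair (by decide), clausenCoeff, show s 3 = 1 / 3 by norm_num [s],
    show (1 - 1 / 3 : ℂ) = 2 / 3 by norm_num]
  push_cast
  ring

lemma R_two_mul_R_four (n : ℕ) : R n 2 * R n 4 = clausenCoeff (s 2) n := by
  rw [R_two, R, show (Finset.Icc 1 4).filter (fun i => Nat.gcd i 4 = 1) = {1, 3} by decide,
    Finset.prod_pair (by decide), clausenCoeff, show s 2 = 1 / 4 by norm_num [s],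
    show (1 - 1 / 4 : ℂ) = 3 / 4 by norm_num]
  push_cast
  ring

end

end RamanujanPi

/-- Over ℂ, `HasSum` means unconditional and hence absolute convergence. The factors 4n and 3n are
n/s for s = 1/4 and s = 1/3. -/
theorem mainTheorem3 :
    (∀ N : ℕ, N = 2 ∨ N = 3 →
      (∃ Y : ℝ, ∀ τ : UpperHalfPlane, Y < τ.im → τ ∈ cuspRegion N) ∧
      ∀ τ ∈ cuspRegion N,
        F2 N τ ^ (1 / 2 : ℂ) =
            ordinaryHypergeometric (s N / 2) ((1 - s N) / 2) (1 : ℂ) (1 / JN N τ) ∧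
        HasSum (fun n : ℕ =>
            poch (1 / 2) n * poch (s N) n * poch (1 - s N) n / (poch 1 n * poch 1 n)
              * (1 / JN N τ) ^ n / (n.factorial : ℂ))
          (F2 N τ)) ∧
    (∀ τ ∈ cuspRegion 2,
      HasSum (fun n : ℕ =>
          (4 * (n : ℂ) + 1 - P2star 2 τ * F2 2 τ / F4 2 τ) * (R n 2 * R n 4 / JN 2 τ ^ n))
        (2 / ((Real.pi : ℂ) * (τ.im : ℂ)) * (F2 2 τ ^ 2 / F4 2 τ))) ∧
    (∀ τ ∈ cuspRegion 3,
      HasSum (fun n : ℕ =>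
          (3 * (n : ℂ) + 1 - P2star 3 τ * F2 3 τ / F4 3 τ) * (R n 2 * R n 3 / JN 3 τ ^ n))
        (3 / (2 * (Real.pi : ℂ) * (τ.im : ℂ)) * (F2 3 τ ^ 2 / F4 3 τ))) := by
  refine ⟨fun N hN => ⟨exists_forall_mem_cuspRegion hN, fun τ hτ => ⟨F2_cpow_half hN hτ, ?_⟩⟩,
    fun τ hτ => ?_, fun τ hτ => ?_⟩
  · refine (hasSum_clausen_F2 hN hτ).congr_fun fun n => ?_
    have h1 : (n.factorial : ℂ) ≠ 0 := by exact_mod_cast n.factorial_ne_zero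
    rw [poch_one, clausenCoeff]
    field_simp
  · have h := hasSum_ramanujan (Or.inl rfl) hτ
    have hc : (6 / ((((2 : ℕ) : ℂ) + 1) * (Real.pi : ℂ) * (τ.im : ℂ)))
        = 2 / ((Real.pi : ℂ) * (τ.im : ℂ)) := by
      push_cast
      ring
    rw [hc] at h
    refine h.congr_fun fun n => ?_
    rw [R_two_mul_R_four, show (n : ℂ) / s 2 = 4 * n by norm_num [s]; ring]
  · have h := hasSum_ramanujan (Or.inr rfl) hτ
    have hc : (6 / ((((3 : ℕ) : ℂ) + 1) * (Real.pi : ℂ) * (τ.im : ℂ)))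
        = 3 / (2 * (Real.pi : ℂ) * (τ.im : ℂ)) := by
      push_cast
      ring
    rw [hc] at h
    refine h.congr_fun fun n => ?_
    rw [R_two_mul_R_three, show (n : ℂ) / s 3 = 3 * n by norm_num [s]; ring]
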